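/- Let $m,r\ge 1$, let $A_0,\dots,A_m\in\mathbb C^{n\times n}$ with $\operatorname{rank}(A_m)=n$, put $P(\lambda)=\sum_{j=0}^m\lambda^jA_j$, and let $\mathbb S=\{\lambda_1,\dots,\lambda_s\}$ be a finite set of complex numbers. For $\Delta\in\mathbb C^{n\times n}$ let $m_j(P+\Delta)$ be the multiplicity of $\lambda_j$ as a root of $\det(P(\lambda)+\Delta)$, and let $$\tau_r(\mathbb S)=\inf\Big\{\|\Delta\|_2:\ \Delta\in\mathbb C^{n\times n},\ \sum_{j=1}^s m_j(P+\Delta)\ge r\Big\}\in[0,\infty].$$ For $\mu\in\mathbb C^r$ and $\Gamma=(\gamma_{ki})_{1\le i<k\le r}\in\mathbb C^{r(r-1)/2}$ let $C(\mu,\Gamma)\in\mathbb C^{r\times r}$ be the upper triangular matrix with diagonal $\mu$ and with entry $\gamma_{ki}$ in position $(i,k)$ for $i<k$. Put $$\mathcal Q(\mu,\Gamma,P)=\sum_{j=0}^m\big(C(\mu,\Gamma)^j\big)^T\otimes A_j\in\mathbb C^{nr\times nr},\qquad \kappa_r(\mu)=\sup_{\Gamma\in\mathbb C^{r(r-1)/2}}\sigma_{-r}\big(\mathcal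 Q(\mu,\Gamma,P)\big)\in[0,\infty],$$ where $\sigma_{-r}$ denotes the $r$-th smallest singular value, counted with multiplicity. Attainment. Suppose $r\le n$ and $\mu\in\mathbb C^r$ is such that all divided differences $P[\mu_k,\mu_l]$, $k<l$, have rank $n$ (with $P[x,y]=(P(y)-P(x))/(y-x)$ for $x\ne y$ and $P[x,x]=P'(x)$). Then the supremum defining $\kappa_r(\mu)$ is attained. Let $\mu\in\mathbb S^r$ be a point where $\inf_{\nu\in\mathbb S^r}\kappa_r(\nu)$ is attained, and let $\Gamma_*$ be a point where the supremum defining $\kappa_r(\mu)$ is attained. Let $U=\operatorname{vec}(\mathcal U)$ and $V=\operatorname{vec}(\mathcal V)$, with $\mathcal U,\mathcal V\in\mathbb C^{n\times r}$ and $\operatorname{vec}$ stacking columns, be unit vectors with $$\mathcal Q(\mu,\Gamma_*,P)V=\kappa_r(\mu)U,\qquad U^*\mathcal Q(\mu,\Gamma_*,P)=\kappa_r(\mu)V^*.$$ Assume that the singular value $\sigma_{-r}(\mathcal Q(\mu,\Gamma_*,P))$ has multiplicity one (multiplicity assumption) and that $\operatorname{rank}(\mathcal V)=r$ (linear independence assumption).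 Then: (i) $\displaystyle \tau_r(\mathbb S)=\inf_{\nu\in\mathbb S^r}\ \sup_{\Gamma\in\mathbb C^{r(r-1)/2}}\sigma_{-r}\big(\mathcal Q(\nu,\Gamma,P)\big).$ (ii) The matrix $\Delta_*=-\kappa_r(\mu)\,\mathcal U\mathcal V^+$, where $\mathcal V^+$ is the Moore–Penrose inverse, satisfies $\sum_{j=1}^s m_j(P+\Delta_*)\ge r$ and $\|\Delta_*\|_2=\tau_r(\mathbb S)$. Thus it is of minimal 2-norm among all $\Delta\in\mathbb C^{n\times n}$ with $\sum_{j=1}^s m_j(P+\Delta)\ge r$. -/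

import Mathlib

open scoped ENNReal Kronecker Matrix

namespace SpecEig

noncomputable section

/-- The matrix polynomial `P(λ) = ∑_{j=0}^m λ^j A_j`, as a matrix with polynomial entries. -/
def matPoly {n m : ℕ} (A : Fin (m + 1) → Matrix (Fin n) (Fin n) ℂ) :
    Matrix (Fin n) (Fin n) (Polynomial ℂ) :=
  ∑ j : Fin (m + 1), (Polynomial.X ^ (j : ℕ) : Polynomial ℂ) • (A j).map Polynomial.C

/-- Algebraic multiplicity of `z` as an eigenvalue of `P + Δ`: its multiplicity as a root of
`det (P(λ) + Δ)`. -/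
def algMult {n m : ℕ} (A : Fin (m + 1) → Matrix (Fin n) (Fin n) ℂ)
    (Δ : Matrix (Fin n) (Fin n) ℂ) (z : ℂ) : ℕ :=
  Polynomial.rootMultiplicity z (matPoly A + Δ.map Polynomial.C).det

/-- `P + Δ` has at least `r` eigenvalues in `S`, counted with algebraic multiplicity. -/
def Feasible {n m : ℕ} (A : Fin (m + 1) → Matrix (Fin n) (Fin n) ℂ) (S : Finset ℂ) (r : ℕ)
    (Δ : Matrix (Fin n) (Fin n) ℂ) : Prop :=
  r ≤ ∑ z ∈ S, algMult A Δ z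

/-- The matrix 2-norm: the operator norm for the Euclidean norm on `ℂⁿ`. -/
def norm2 {n : ℕ} (Δ : Matrix (Fin n) (Fin n) ℂ) : ℝ :=
  ‖Matrix.toEuclideanCLM (n := Fin n) (𝕜 := ℂ) Δ‖

/-- The distance `τ_r(S)`, with value `∞` when no perturbation is feasible. -/
def tau {n m : ℕ} (A : Fin (m + 1) → Matrix (Fin n) (Fin n) ℂ) (S : Finset ℂ) (r : ℕ) : ℝ≥0∞ :=
  ⨅ (Δ : Matrix (Fin n) (Fin n) ℂ) (_ : Feasible A S r Δ), ENNReal.ofReal (norm2 Δ)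

/-- Positions strictly above the diagonal of an `r × r` matrix; there are `r(r-1)/2` of them. -/
abbrev StrictUpper (r : ℕ) : Type := {p : Fin r × Fin r // p.1 < p.2}

/-- The upper triangular matrix `C(μ, Γ)` with diagonal `μ` and strictly upper part `Γ`. -/
def Cmat {r : ℕ} (μ : Fin r → ℂ) (Γ : StrictUpper r → ℂ) : Matrix (Fin r) (Fin r) ℂ :=
  Matrix.of fun i j => if i = j then μ i else if h : i < j then Γ ⟨(i, j), h⟩ else 0

/-- `Q(μ, Γ, P) = ∑_j (C(μ, Γ)^j)ᵀ ⊗ A_j`. -/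
def Qmat {n m r : ℕ} (A : Fin (m + 1) → Matrix (Fin n) (Fin n) ℂ) (μ : Fin r → ℂ)
    (Γ : StrictUpper r → ℂ) : Matrix (Fin r × Fin n) (Fin r × Fin n) ℂ :=
  ∑ j : Fin (m + 1), (Cmat μ Γ ^ (j : ℕ))ᵀ ⊗ₖ A j

/-- The singular values of a square matrix in decreasing order, indexed from `0`. -/
def singVal {ι : Type} [Fintype ι] [DecidableEq ι] (B : Matrix ι ι ℂ) (i : ℕ) : ℝ :=
  (Matrix.toEuclideanLin B).singularValues i

/-- The `k`-th smallest singular value `σ_{-k}(B)`, for `1 ≤ k ≤ card ι`. -/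
def sigmaNeg {ι : Type} [Fintype ι] [DecidableEq ι] (k : ℕ) (B : Matrix ι ι ℂ) : ℝ :=
  singVal B (Fintype.card ι - k)

/-- The multiplicity of the real number `s` as a singular value of `B`. -/
def singValMult {ι : Type} [Fintype ι] [DecidableEq ι] (B : Matrix ι ι ℂ) (s : ℝ) : ℕ :=
  Set.ncard {i : ℕ | i < Fintype.card ι ∧ singVal B i = s}

/-- `κ_r(μ) = sup_Γ σ_{-r}(Q(μ, Γ, P))`, possibly `∞`. -/
def kappa {n m r : ℕ} (A : Fin (m + 1) → Matrix (Fin n) (Fin n) ℂ) (μ : Fin r → ℂ) : ℝ≥0∞ :=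
  ⨆ Γ : StrictUpper r → ℂ, ENNReal.ofReal (sigmaNeg r (Qmat A μ Γ))

/-- The supremum defining `κ_r(μ)` is attained at `Γ`. -/
def AttainedAt {n m r : ℕ} (A : Fin (m + 1) → Matrix (Fin n) (Fin n) ℂ) (μ : Fin r → ℂ)
    (Γ : StrictUpper r → ℂ) : Prop :=
  kappa A μ = ENNReal.ofReal (sigmaNeg r (Qmat A μ Γ))

/-- `μ ∈ S^r` and the infimum of `κ_r` over `S^r` is attained at `μ`. -/
def OuterOptimal {n m r : ℕ} (A : Fin (m + 1) → Matrix (Fin n) (Fin n) ℂ) (S : Finset ℂ)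
    (μ : Fin r → ℂ) : Prop :=
  (∀ i, μ i ∈ S) ∧ ∀ ν : Fin r → ℂ, (∀ i, ν i ∈ S) → kappa A μ ≤ kappa A ν

/-- `vec U`, `vec V` is a consistent pair of unit left and right singular vectors of `Q` for the
singular value `s`; `vec` stacks columns. -/
def SingularPair {n r : ℕ} (Q : Matrix (Fin r × Fin n) (Fin r × Fin n) ℂ) (s : ℝ)
    (U V : Matrix (Fin n) (Fin r) ℂ) : Prop :=
  ‖WithLp.toLp 2 U.vec‖ = 1 ∧ ‖WithLp.toLp 2 V.vec‖ = 1 ∧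
    Q *ᵥ V.vec = (s : ℂ) • U.vec ∧ star U.vec ᵥ* Q = (s : ℂ) • star V.vec

/-- The Moore-Penrose inverse `V⁺ = (VᴴV)⁻¹Vᴴ` of a matrix with full column rank. -/
def pinv {n r : ℕ} (V : Matrix (Fin n) (Fin r) ℂ) : Matrix (Fin r) (Fin n) ℂ :=
  (Vᴴ * V)⁻¹ * Vᴴ

open scoped ComplexOrder in
/-- For full column rank, `pinv V` satisfies the four Penrose equations. -/
theorem pinv_penrose {n r : ℕ} (V : Matrix (Fin n) (Fin r) ℂ) (hV : V.rank = r) :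
    V * pinv V * V = V ∧ pinv V * V * pinv V = pinv V ∧
      (V * pinv V)ᴴ = V * pinv V ∧ (pinv V * V)ᴴ = pinv V * V := by
  have hu : IsUnit (Vᴴ * V) := by
    rw [← Matrix.mulVec_injective_iff_isUnit, ← Matrix.coe_mulVecLin]
    have h : (Vᴴ * V).rank = r := by rw [Matrix.rank_conjTranspose_mul_self, hV]
    rw [LinearMap.injective_iff_surjective, ← LinearMap.range_eq_top]
    apply Submodule.eq_top_of_finrank_eq
    rw [← Matrix.rank, h]; simp
  have hd : IsUnit (Vᴴ * V).det := (Matrix.isUnit_iff_isUnit_det _).1 hu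
  have h1 : pinv V * V = 1 := by
    rw [pinv, Matrix.mul_assoc, Matrix.nonsing_inv_mul _ hd]
  refine ⟨by rw [Matrix.mul_assoc, h1, Matrix.mul_one], by rw [h1, Matrix.one_mul], ?_,
    by rw [h1, Matrix.conjTranspose_one]⟩
  simp only [pinv, Matrix.conjTranspose_mul, Matrix.conjTranspose_nonsing_inv,
    Matrix.conjTranspose_conjTranspose, Matrix.mul_assoc]

/-- The perturbation `Δ_* = -κ_r(μ) U V⁺`. -/
def optPert {n m r : ℕ} (A : Fin (m + 1) → Matrix (Fin n) (Fin n) ℂ) (μ : Fin r → ℂ)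
    (U V : Matrix (Fin n) (Fin r) ℂ) : Matrix (Fin n) (Fin n) ℂ :=
  -(((kappa A μ).toReal : ℂ) • (U * pinv V))

/-- The divided difference `P[x, y]`: it is `(P(y) - P(x)) / (y - x)` for `x ≠ y` and `P'(x)` for
`x = y`, because `(y^j - x^j) / (y - x) = ∑_{i<j} x^i y^{j-1-i}`. -/
def divDiff {n m : ℕ} (A : Fin (m + 1) → Matrix (Fin n) (Fin n) ℂ) (x y : ℂ) :
    Matrix (Fin n) (Fin n) ℂ :=
  ∑ j : Fin (m + 1), (∑ i ∈ Finset.range j, x ^ i * y ^ ((j : ℕ) - 1 - i)) • A j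

end

end SpecEig

open SpecEig

/-!
If `P + Δ` has the eigenvalues `μ₁, …, μᵣ`, the Smith form of `P + Δ` shows that
`Q(μ, Γ, P) + I ⊗ Δ = Q(μ, Γ, P + Δ)` has nullity at least `r` for every `Γ`, hence
`σ₋ᵣ(Q(μ, Γ, P)) ≤ ‖Δ‖` and `inf κᵣ ≤ τᵣ(S)`.

Conversely, at a maximizing `Γ` with simple singular value `s`, the derivative of `s` in each entry
of `Γ` vanishes. The entries of `Γ` pair with a matrix `M` for which stationarity says that `M` is
upper triangular, and `M C - C M = s (U*U - V*V)` with `C = C(μ, Γ)` upper triangular too. The right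
side is Hermitian and the left side vanishes on and below the diagonal, so `U*U = V*V` and
`‖U V⁺‖ ≤ 1`. Finally `Δ = -s U V⁺` makes `(V, C)` an invariant pair of `P + Δ`, so that
`∏ (X - μᵢ)` divides `det (P + Δ)`.

For attainment one shows that `σ₋ᵣ(Q(μ, Γ, P)) ≥ ε > 0` bounds `Γ`, one diagonal after the other:
if the diagonals before that of `γ` at `(i, k)` are bounded, then, because `P[μᵢ, μₖ]` is
invertible, a perturbation of size `O(1 / |γ|)` annihilates a block of `Q(μ, Γ, P)` large enough
to lower the rank by `n ≥ r`.
-/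

namespace SpecEig

open Module Filter Topology Polynomial Asymptotics
open scoped Matrix.Norms.L2Operator

section SingularValues

variable {𝕜 E F : Type*} [RCLike 𝕜] [NormedAddCommGroup E] [InnerProductSpace 𝕜 E]
  [FiniteDimensional 𝕜 E] [NormedAddCommGroup F] [InnerProductSpace 𝕜 F] [FiniteDimensional 𝕜 F]

/-- An orthonormal basis of right singular vectors of `T`, in the order of the singular values. -/
noncomputable def singBasis (T : E →ₗ[𝕜] F) : OrthonormalBasis (Fin (finrank 𝕜 E)) 𝕜 E :=
  T.isSymmetric_adjoint_comp_self.eigenvectorBasis rfl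

theorem repr_adjoint_apply (T : E →ₗ[𝕜] F) (x : E) (i : Fin (finrank 𝕜 E)) :
    (singBasis T).repr (T.adjoint (T x)) i =
      ((T.singularValues i ^ 2 : ℝ) : 𝕜) * (singBasis T).repr x i := by
  rw [T.sq_singularValues_fin rfl i]
  exact T.isSymmetric_adjoint_comp_self.eigenvectorBasis_apply_self_apply rfl x i

theorem norm_sq_apply_sub_eq_sum (T : E →ₗ[𝕜] F) (c : ℝ) (x : E) :
    ‖T x‖ ^ 2 - c ^ 2 * ‖x‖ ^ 2 = ∑ i : Fin (finrank 𝕜 E),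
      (T.singularValues i ^ 2 - c ^ 2) * ‖(singBasis T).repr x i‖ ^ 2 := by
  have h : ‖T x‖ ^ 2 = RCLike.re (inner 𝕜 x (T.adjoint (T x))) := by
    rw [LinearMap.adjoint_inner_right, inner_self_eq_norm_sq]
  rw [h, ← (singBasis T).repr.inner_map_map, PiLp.inner_apply, map_sum,
    ← (singBasis T).repr.norm_map, EuclideanSpace.norm_sq_eq, Finset.mul_sum,
    ← Finset.sum_sub_distrib]
  refine Finset.sum_congr rfl fun i _ => ?_
  rw [repr_adjoint_apply, ← smul_eq_mul, inner_smul_right, RCLike.re_ofReal_mul,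
    inner_self_eq_norm_sq, sub_mul]

/-- The span of the right singular vectors with indices in `s`. -/
noncomputable def singSpan (T : E →ₗ[𝕜] F) (s : Finset (Fin (finrank 𝕜 E))) : Submodule 𝕜 E :=
  Submodule.span 𝕜 (singBasis T '' s)

theorem finrank_singSpan (T : E →ₗ[𝕜] F) (s : Finset (Fin (finrank 𝕜 E))) :
    finrank 𝕜 (singSpan T s) = s.card := by
  have h := ((singBasis T).orthonormal.comp _ (Subtype.val_injective (p := (· ∈ s))))
  rw [singSpan, Set.image_eq_range]
  exact (finrank_span_eq_card h.linearIndependent).trans (Fintype.card_coe s)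

theorem mem_singSpan_iff {T : E →ₗ[𝕜] F} {s : Finset (Fin (finrank 𝕜 E))} {x : E} :
    x ∈ singSpan T s ↔ ∀ i ∉ s, (singBasis T).repr x i = 0 := by
  rw [singSpan, ← (singBasis T).coe_toBasis, (singBasis T).toBasis.mem_span_image]
  simp only [Set.subset_def, Finset.mem_coe, Finsupp.mem_support_iff,
    (singBasis T).coe_toBasis_repr_apply]
  exact forall_congr' fun i => not_imp_comm

theorem norm_apply_le_of_mem_singSpan {T : E →ₗ[𝕜] F} {s : Finset (Fin (finrank 𝕜 E))} {c : ℝ}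
    (hc : 0 ≤ c) (hs : ∀ i ∈ s, T.singularValues i ≤ c) {x : E} (hx : x ∈ singSpan T s) :
    ‖T x‖ ≤ c * ‖x‖ := by
  refine le_of_sq_le_sq ?_ (mul_nonneg hc (norm_nonneg x))
  rw [mul_pow, ← sub_nonpos, norm_sq_apply_sub_eq_sum]
  refine Finset.sum_nonpos fun i _ => ?_
  by_cases hi : i ∈ s
  · exact mul_nonpos_of_nonpos_of_nonneg
      (sub_nonpos.2 (pow_le_pow_left₀ (T.singularValues_nonneg i) (hs i hi) 2)) (sq_nonneg _)
  · simp [mem_singSpan_iff.1 hx i hi]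

theorem sq_sub_mul_norm_repr_nonneg {T : E →ₗ[𝕜] F} {s : Finset (Fin (finrank 𝕜 E))} {c : ℝ}
    (hc : 0 ≤ c) (hs : ∀ i ∈ s, c ≤ T.singularValues i) {x : E} (hx : x ∈ singSpan T s)
    (i : Fin (finrank 𝕜 E)) :
    0 ≤ (T.singularValues i ^ 2 - c ^ 2) * ‖(singBasis T).repr x i‖ ^ 2 := by
  by_cases hi : i ∈ s
  · exact mul_nonneg (sub_nonneg.2 (pow_le_pow_left₀ hc (hs i hi) 2)) (sq_nonneg _)
  · simp [mem_singSpan_iff.1 hx i hi]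

theorem le_norm_apply_of_mem_singSpan {T : E →ₗ[𝕜] F} {s : Finset (Fin (finrank 𝕜 E))} {c : ℝ}
    (hc : 0 ≤ c) (hs : ∀ i ∈ s, c ≤ T.singularValues i) {x : E} (hx : x ∈ singSpan T s) :
    c * ‖x‖ ≤ ‖T x‖ := by
  refine le_of_sq_le_sq ?_ (norm_nonneg _)
  rw [mul_pow, ← sub_nonneg, norm_sq_apply_sub_eq_sum]
  exact Finset.sum_nonneg fun i _ => sq_sub_mul_norm_repr_nonneg hc hs hx i

theorem singularValues_eq_of_repr_ne_zero {T : E →ₗ[𝕜] F} {s : Finset (Fin (finrank 𝕜 E))} {c : ℝ}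
    (hc : 0 ≤ c) (hs : ∀ i ∈ s, c ≤ T.singularValues i) {x : E} (hx : x ∈ singSpan T s)
    (hTx : ‖T x‖ ≤ c * ‖x‖) {i : Fin (finrank 𝕜 E)} (hi : (singBasis T).repr x i ≠ 0) :
    T.singularValues i = c := by
  have hsum : ∑ j : Fin (finrank 𝕜 E),
      (T.singularValues j ^ 2 - c ^ 2) * ‖(singBasis T).repr x j‖ ^ 2 = 0 := by
    refine le_antisymm ?_ (Finset.sum_nonneg fun j _ => sq_sub_mul_norm_repr_nonneg hc hs hx j)
    rw [← norm_sq_apply_sub_eq_sum, sub_nonpos, ← mul_pow]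
    exact pow_le_pow_left₀ (norm_nonneg _) hTx 2
  have hzero := (Finset.sum_eq_zero_iff_of_nonneg
    fun j _ => sq_sub_mul_norm_repr_nonneg hc hs hx j).1 hsum i (Finset.mem_univ i)
  have hsq := (mul_eq_zero.1 hzero).resolve_right (pow_ne_zero 2 (norm_ne_zero_iff.2 hi))
  exact (pow_left_inj₀ (T.singularValues_nonneg i) hc two_ne_zero).1 (sub_eq_zero.1 hsq)

theorem exists_ne_zero_mem_inf {K V : Type*} [DivisionRing K] [AddCommGroup V] [Module K V]
    [FiniteDimensional K V] {W W' : Submodule K V}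
    (h : finrank K V < finrank K W + finrank K W') : ∃ x ∈ W ⊓ W', x ≠ 0 := by
  refine Submodule.exists_mem_ne_zero_of_ne_bot fun h0 => ?_
  have hdim := Submodule.finrank_sup_add_finrank_inf_eq W W'
  have hle := (W ⊔ W').finrank_le
  rw [h0, finrank_bot] at hdim
  omega

theorem finrank_singSpan_head (T : E →ₗ[𝕜] F) {k : ℕ} (hk : k < finrank 𝕜 E) :
    finrank 𝕜 (singSpan T {i | (i : ℕ) < k + 1}) = k + 1 := by
  rw [finrank_singSpan, Fin.card_filter_val_lt]
  omega

theorem le_singularValues_of_mem_head (T : E →ₗ[𝕜] F) (k : ℕ) (i : Fin (finrank 𝕜 E))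
    (hi : i ∈ ({i | (i : ℕ) < k + 1} : Finset (Fin (finrank 𝕜 E)))) :
    T.singularValues k ≤ T.singularValues i :=
  T.singularValues_antitone (Nat.le_of_lt_succ (Finset.mem_filter.1 hi).2)

theorem singularValues_le_of_subspace (T : E →ₗ[𝕜] F) {k : ℕ} {s : ℝ} (hs : 0 ≤ s)
    (W : Submodule 𝕜 E) (hW : finrank 𝕜 E ≤ finrank 𝕜 W + k) (h : ∀ x ∈ W, ‖T x‖ ≤ s * ‖x‖) :
    T.singularValues k ≤ s := by
  rcases lt_or_ge k (finrank 𝕜 E) with hk | hk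
  · have hdim := finrank_singSpan_head T hk
    obtain ⟨x, ⟨hx, hx'⟩, hx0⟩ := exists_ne_zero_mem_inf
      (W := W) (W' := singSpan T {i | (i : ℕ) < k + 1}) (by omega)
    have hle := le_norm_apply_of_mem_singSpan (T.singularValues_nonneg k)
      (le_singularValues_of_mem_head T k) hx'
    exact le_of_mul_le_mul_right (hle.trans (h x hx)) (norm_pos_iff.2 hx0)
  · rwa [T.singularValues_of_finrank_le hk]

theorem exists_subspace_norm_apply_le (T : E →ₗ[𝕜] F) (k : ℕ) :
    ∃ W : Submodule 𝕜 E, finrank 𝕜 E ≤ finrank 𝕜 W + k ∧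
      ∀ x ∈ W, ‖T x‖ ≤ T.singularValues k * ‖x‖ := by
  refine ⟨singSpan T ({i | (i : ℕ) < k} : Finset (Fin (finrank 𝕜 E)))ᶜ, ?_, fun x hx =>
    norm_apply_le_of_mem_singSpan (T.singularValues_nonneg k) (fun i hi => ?_) hx⟩
  · rw [finrank_singSpan, Finset.card_compl, Fintype.card_fin, Fin.card_filter_val_lt]
    omega
  · exact T.singularValues_antitone (by simpa using hi)

theorem singularValues_le_add (T T' : E →L[𝕜] F) (k : ℕ) :
    (T' : E →ₗ[𝕜] F).singularValues k ≤ (T : E →ₗ[𝕜] F).singularValues k + ‖T' - T‖ := by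
  obtain ⟨W, hW, h⟩ := exists_subspace_norm_apply_le (T : E →ₗ[𝕜] F) k
  refine singularValues_le_of_subspace _
    (add_nonneg (LinearMap.singularValues_nonneg _ _) (norm_nonneg _)) W hW fun x hx => ?_
  calc ‖T' x‖ = ‖T x + (T' - T) x‖ := by simp
    _ ≤ ‖T x‖ + ‖(T' - T) x‖ := norm_add_le _ _
    _ ≤ _ * ‖x‖ + ‖T' - T‖ * ‖x‖ := add_le_add (h x hx) ((T' - T).le_opNorm x)
    _ = _ := (add_mul _ _ _).symm

theorem continuous_singularValues (k : ℕ) :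
    Continuous fun T : E →L[𝕜] F => (T : E →ₗ[𝕜] F).singularValues k := by
  have hlip : LipschitzWith 1 fun T : E →L[𝕜] F => (T : E →ₗ[𝕜] F).singularValues k :=
    .of_le_add fun T T' => by
      rw [dist_eq_norm]
      exact singularValues_le_add T' T k
  exact hlip.continuous

/-- `σ_k(T)` is attained only by the index `k`: the singular value `σ_k(T)` has multiplicity one. -/
def IsSimpleSingularValue (T : E →ₗ[𝕜] F) (k : ℕ) : Prop :=
  k < finrank 𝕜 E ∧ ∀ i < finrank 𝕜 E, T.singularValues i = T.singularValues k → i = k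

theorem IsSimpleSingularValue.eq_smul {T : E →ₗ[𝕜] F} {k : ℕ} (h : IsSimpleSingularValue T k)
    {x : E} (hx : ∀ i, (singBasis T).repr x i ≠ 0 → T.singularValues i = T.singularValues k) :
    x = (singBasis T).repr x ⟨k, h.1⟩ • singBasis T ⟨k, h.1⟩ := by
  conv_lhs => rw [← (singBasis T).sum_repr x]
  refine Finset.sum_eq_single _ (fun i _ hik => ?_) (by simp)
  rw [not_imp_comm.1 (hx i) fun hi => hik (Fin.ext (h.2 i i.2 hi)), zero_smul]

theorem singularValues_eq_of_adjoint_apply_eq {T : E →ₗ[𝕜] F} {c : ℝ} (hc : 0 ≤ c) {v : E}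
    (hv : T.adjoint (T v) = ((c ^ 2 : ℝ) : 𝕜) • v) {i : Fin (finrank 𝕜 E)}
    (hi : (singBasis T).repr v i ≠ 0) : T.singularValues i = c := by
  have h := repr_adjoint_apply T v i
  rw [hv, map_smul, PiLp.smul_apply, smul_eq_mul] at h
  exact (pow_left_inj₀ (T.singularValues_nonneg i) hc two_ne_zero).1
    (RCLike.ofReal_injective (mul_right_cancel₀ hi h)).symm

omit [FiniteDimensional 𝕜 F] in
theorem re_inner_nonpos_of_norm_add_smul_le {a b : F} {t : ℝ} (ht : 0 < t)
    (h : ‖a + (t : 𝕜) • b‖ ≤ ‖a‖) : RCLike.re (inner 𝕜 a b) ≤ 0 := by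
  have hsq := pow_le_pow_left₀ (norm_nonneg _) h 2
  rw [norm_add_sq (𝕜 := 𝕜), inner_smul_right, RCLike.re_ofReal_mul] at hsq
  have hmul : t * RCLike.re (inner 𝕜 a b) ≤ 0 := by linarith [sq_nonneg ‖(t : 𝕜) • b‖]
  exact nonpos_of_mul_nonpos_right hmul ht

omit [FiniteDimensional 𝕜 E] [FiniteDimensional 𝕜 F] in
theorem re_inner_apply_smul (T B : E →L[𝕜] F) (a : 𝕜) (x : E) :
    RCLike.re (inner 𝕜 (T (a • x)) (B (a • x))) = ‖a‖ ^ 2 * RCLike.re (inner 𝕜 (T x) (B x)) := by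
  rw [map_smul, map_smul, inner_smul_left, inner_smul_right, ← mul_assoc, RCLike.conj_mul,
    ← RCLike.ofReal_pow, RCLike.re_ofReal_mul]

theorem exists_unit_head_norm_apply_le (T T' : E →ₗ[𝕜] F) {k : ℕ} (hk : k < finrank 𝕜 E)
    (h : T'.singularValues k ≤ T.singularValues k) :
    ∃ x ∈ singSpan T {i | (i : ℕ) < k + 1}, ‖x‖ = 1 ∧ ‖T' x‖ ≤ T.singularValues k := by
  obtain ⟨W, hW, hT'⟩ := exists_subspace_norm_apply_le T' k
  have hdim := finrank_singSpan_head T hk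
  obtain ⟨y, ⟨hyW, hy⟩, hy0⟩ := exists_ne_zero_mem_inf
    (W := W) (W' := singSpan T {i | (i : ℕ) < k + 1}) (by omega)
  have hunit : ‖((‖y‖⁻¹ : ℝ) : 𝕜) • y‖ = 1 := by
    rw [norm_smul, RCLike.norm_ofReal, abs_inv, abs_norm, inv_mul_cancel₀ (norm_ne_zero_iff.2 hy0)]
  refine ⟨((‖y‖⁻¹ : ℝ) : 𝕜) • y, Submodule.smul_mem _ _ hy, hunit, ?_⟩
  have hle := hT' _ (W.smul_mem ((‖y‖⁻¹ : ℝ) : 𝕜) hyW)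
  rw [hunit, mul_one] at hle
  exact hle.trans h

/-- The vector `x` is a limit of unit vectors `wⱼ` of the head space with
`‖(T + tⱼ Dⱼ) wⱼ‖ ≤ σ_k(T)`. Since `σ_k(T) ≤ ‖T wⱼ‖`, the first-order term cannot be positive. -/
theorem exists_unit_head_re_inner_nonpos {T B : E →L[𝕜] F} {k : ℕ} (hk : k < finrank 𝕜 E)
    {t : ℕ → ℝ} {D : ℕ → E →L[𝕜] F} (ht : ∀ j, 0 < t j) (ht0 : Tendsto t atTop (𝓝 0))
    (hD : Tendsto D atTop (𝓝 B))
    (hmax : ∀ j, ((T + (t j : 𝕜) • D j : E →L[𝕜] F) : E →ₗ[𝕜] F).singularValues k ≤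
      (T : E →ₗ[𝕜] F).singularValues k) :
    ∃ x ∈ singSpan (T : E →ₗ[𝕜] F) {i | (i : ℕ) < k + 1}, ‖x‖ = 1 ∧
      ‖T x‖ ≤ (T : E →ₗ[𝕜] F).singularValues k ∧ RCLike.re (inner 𝕜 (T x) (B x)) ≤ 0 := by
  choose w hw hw1 hwT using fun j => exists_unit_head_norm_apply_le _ _ hk (hmax j)
  have : ProperSpace E := FiniteDimensional.proper_rclike 𝕜 E
  obtain ⟨x, hx1, φ, hφ, hwx⟩ :=
    (isCompact_sphere (0 : E) 1).tendsto_subseq fun j => mem_sphere_zero_iff_norm.2 (hw1 j)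
  have hDx : Tendsto (fun j => D (φ j) (w (φ j))) atTop (𝓝 (B x)) :=
    ((isBoundedBilinearMap_apply (𝕜 := 𝕜)).continuous.tendsto (B, x)).comp
      ((hD.comp hφ.tendsto_atTop).prodMk_nhds hwx)
  have hTx : Tendsto (fun j => T (w (φ j))) atTop (𝓝 (T x)) := (T.continuous.tendsto x).comp hwx
  have htφ : Tendsto (fun j => (t (φ j) : 𝕜)) atTop (𝓝 0) := by
    rw [← RCLike.ofReal_zero]
    exact ((RCLike.continuous_ofReal (K := 𝕜)).tendsto 0).comp (ht0.comp hφ.tendsto_atTop)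
  refine ⟨x, (Submodule.closed_of_finiteDimensional _).mem_of_tendsto hwx
    (Eventually.of_forall fun j => hw (φ j)), mem_sphere_zero_iff_norm.1 hx1, ?_, ?_⟩
  · have hlim := (hTx.add (htφ.smul hDx)).norm
    rw [zero_smul, add_zero] at hlim
    exact le_of_tendsto hlim (Eventually.of_forall fun j => hwT (φ j))
  · refine le_of_tendsto ((RCLike.continuous_re.tendsto _).comp (hTx.inner hDx))
      (Eventually.of_forall fun j => re_inner_nonpos_of_norm_add_smul_le (ht (φ j)) ?_)
    have hle := le_norm_apply_of_mem_singSpan (LinearMap.singularValues_nonneg _ k)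
      (le_singularValues_of_mem_head _ k) (hw (φ j))
    rw [hw1, mul_one] at hle
    exact (hwT (φ j)).trans hle

theorem IsSimpleSingularValue.re_inner_nonpos {T B : E →L[𝕜] F} {k : ℕ}
    (hT : IsSimpleSingularValue (T : E →ₗ[𝕜] F) k) {t : ℕ → ℝ} {D : ℕ → E →L[𝕜] F}
    (ht : ∀ j, 0 < t j) (ht0 : Tendsto t atTop (𝓝 0)) (hD : Tendsto D atTop (𝓝 B))
    (hmax : ∀ j, ((T + (t j : 𝕜) • D j : E →L[𝕜] F) : E →ₗ[𝕜] F).singularValues k ≤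
      (T : E →ₗ[𝕜] F).singularValues k) {v : E}
    (hv : LinearMap.adjoint (T : E →ₗ[𝕜] F) (T v) =
      (((T : E →ₗ[𝕜] F).singularValues k ^ 2 : ℝ) : 𝕜) • v) :
    RCLike.re (inner 𝕜 (T v) (B v)) ≤ 0 := by
  have hσ := (T : E →ₗ[𝕜] F).singularValues_nonneg k
  obtain ⟨x, hx, hx1, hTx, hre⟩ := exists_unit_head_re_inner_nonpos hT.1 ht ht0 hD hmax
  have hxb := hT.eq_smul fun i => singularValues_eq_of_repr_ne_zero hσ
    (le_singularValues_of_mem_head _ k) hx (by rwa [hx1, mul_one])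
  rw [hxb, norm_smul, (singBasis _).orthonormal.1, mul_one] at hx1
  rw [hxb, re_inner_apply_smul, hx1, one_pow, one_mul] at hre
  rw [hT.eq_smul fun i => singularValues_eq_of_adjoint_apply_eq hσ hv, re_inner_apply_smul]
  exact mul_nonpos_of_nonneg_of_nonpos (sq_nonneg _) hre

end SingularValues

section SimpleSingularValue

variable {E F : Type*} [NormedAddCommGroup E] [InnerProductSpace ℂ E] [FiniteDimensional ℂ E]
  [NormedAddCommGroup F] [InnerProductSpace ℂ F] [FiniteDimensional ℂ F]

theorem IsSimpleSingularValue.re_inner_deriv_nonpos {f : ℝ → E →L[ℂ] F} {B : E →L[ℂ] F} {k : ℕ}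
    (hf : HasDerivAt f B 0) (h0 : IsSimpleSingularValue (f 0 : E →ₗ[ℂ] F) k)
    (hmax : ∀ t, (f t : E →ₗ[ℂ] F).singularValues k ≤ (f 0 : E →ₗ[ℂ] F).singularValues k) {v : E}
    (hv : LinearMap.adjoint (f 0 : E →ₗ[ℂ] F) (f 0 v) =
      (((f 0 : E →ₗ[ℂ] F).singularValues k ^ 2 : ℝ) : ℂ) • v) :
    (inner ℂ (f 0 v) (B v)).re ≤ 0 := by
  have ht : ∀ j : ℕ, 0 < 1 / ((j : ℝ) + 1) := fun j => by positivity
  have hlim := tendsto_one_div_add_atTop_nhds_zero_nat (𝕜 := ℝ)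
  have hslope := hasDerivAt_iff_tendsto_slope_zero.1 hf |>.comp
    (tendsto_nhdsWithin_iff.2 ⟨hlim, Eventually.of_forall fun j => (ht j).ne'⟩)
  refine h0.re_inner_nonpos ht hlim hslope (fun j => ?_) hv
  refine (congrArg (fun T : E →L[ℂ] F => (T : E →ₗ[ℂ] F).singularValues k) ?_).trans_le
    (hmax (1 / ((j : ℝ) + 1)))
  simp only [Function.comp_apply, zero_add]
  rw [RCLike.ofReal_eq_complex_ofReal, Complex.coe_smul, smul_inv_smul₀ (ht j).ne', add_sub_cancel]

theorem IsSimpleSingularValue.re_inner_deriv_eq_zero {f : ℝ → E →L[ℂ] F} {B : E →L[ℂ] F} {k : ℕ}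
    (hf : HasDerivAt f B 0) (h0 : IsSimpleSingularValue (f 0 : E →ₗ[ℂ] F) k)
    (hmax : ∀ t, (f t : E →ₗ[ℂ] F).singularValues k ≤ (f 0 : E →ₗ[ℂ] F).singularValues k) {v : E}
    (hv : LinearMap.adjoint (f 0 : E →ₗ[ℂ] F) (f 0 v) =
      (((f 0 : E →ₗ[ℂ] F).singularValues k ^ 2 : ℝ) : ℂ) • v) :
    (inner ℂ (f 0 v) (B v)).re = 0 := by
  refine le_antisymm (h0.re_inner_deriv_nonpos hf hmax hv) ?_
  have hneg : HasDerivAt (fun t => f (-t)) (-B) 0 := by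
    simpa [Function.comp_def] using
      HasDerivAt.scomp (0 : ℝ) (by simpa using hf) (hasDerivAt_neg (0 : ℝ))
  have h := IsSimpleSingularValue.re_inner_deriv_nonpos (k := k) (v := v) hneg
    (by simpa using h0) (fun t => by simpa using hmax (-t)) (by simpa using hv)
  simpa using h

end SimpleSingularValue

section RootCounting

theorem exists_map_univ_le {α : Type*} {M : Multiset α} {r : ℕ} (h : r ≤ M.card) :
    ∃ ν : Fin r → α, Finset.univ.val.map ν ≤ M := by
  have hr : r ≤ M.toList.length := by rwa [Multiset.length_toList]
  refine ⟨Fin.take r hr M.toList.get, ?_⟩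
  rw [Fin.univ_val_map, Fin.ofFn_take_get]
  exact (Multiset.coe_le.2 (List.take_sublist r _).subperm).trans_eq M.coe_toList

theorem le_sum_rootMultiplicity_iff {K : Type*} [Field K] {p : K[X]} (hp : p ≠ 0) {S : Finset K}
    {r : ℕ} : r ≤ ∑ z ∈ S, p.rootMultiplicity z ↔
      ∃ ν : Fin r → K, (∀ i, ν i ∈ S) ∧ ∏ i, (X - C (ν i)) ∣ p := by
  classical
  have hsum : ∑ z ∈ S, p.rootMultiplicity z = (p.roots.filter (· ∈ S)).card := by
    rw [← Multiset.sum_count_eq_card fun z hz => (Multiset.mem_filter.1 hz).2]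
    exact Finset.sum_congr rfl fun z hz => by rw [Multiset.count_filter_of_pos hz, count_roots]
  have hdvd : ∀ ν : Fin r → K, ∏ i, (X - C (ν i)) ∣ p ↔ Finset.univ.val.map ν ≤ p.roots := by
    intro ν
    rw [← Multiset.prod_X_sub_C_dvd_iff_le_roots hp, Multiset.map_map]
    rfl
  simp only [hsum, hdvd]
  constructor
  · intro h
    obtain ⟨ν, hν⟩ := exists_map_univ_le h
    exact ⟨ν, fun i => (Multiset.mem_filter.1
      (Multiset.mem_of_le hν (Multiset.mem_map_of_mem ν (Finset.mem_univ i)))).2,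
      hν.trans (Multiset.filter_le _ _)⟩
  · rintro ⟨ν, hνS, hν⟩
    have hle : Finset.univ.val.map ν ≤ p.roots.filter (· ∈ S) :=
      Multiset.le_filter.2 ⟨hν, by simpa using hνS⟩
    simpa using Multiset.card_le_card hle

end RootCounting

section Nullity

theorem exists_smith_form {ι R : Type*} [Fintype ι] [DecidableEq ι] [CommRing R]
    [IsDomain R] [IsPrincipalIdealRing R] {P : Matrix ι ι R} (hP : P.det ≠ 0) :
    ∃ (E F : Matrix ι ι R) (a : ι → R), IsUnit E.det ∧ IsUnit F.det ∧
      P = E * Matrix.diagonal a * F := by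
  have hinj : Function.Injective (Matrix.toLin' P) := by
    refine LinearMap.ker_eq_bot.1 (LinearMap.ker_eq_bot'.2 fun v hv => ?_)
    exact Matrix.eq_zero_of_mulVec_eq_zero hP (by simpa using hv)
  let e := LinearEquiv.ofInjective (Matrix.toLin' P) hinj
  obtain ⟨b, a, c, hc⟩ := Submodule.exists_smith_normal_form_of_rank_eq
    (N := LinearMap.range (Matrix.toLin' P)) (Pi.basisFun R ι) e.finrank_eq.symm
  have hP : LinearMap.toMatrix (c.map e.symm) b (Matrix.toLin' P) = Matrix.diagonal a := by
    ext i j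
    have hPc : Matrix.toLin' P (c.map e.symm j) = a j • b j := by
      rw [← hc j, Basis.map_apply]
      exact congrArg Subtype.val (e.apply_symm_apply (c j))
    rw [LinearMap.toMatrix_apply, hPc, map_smul, Basis.repr_self, Finsupp.smul_single,
      smul_eq_mul, mul_one, Finsupp.single_apply, Matrix.diagonal_apply]
    grind
  refine ⟨(Pi.basisFun R ι).toMatrix b, (c.map e.symm).toMatrix (Pi.basisFun R ι), a, ?_, ?_, ?_⟩
  · rw [← Basis.det_apply]
    exact Basis.isUnit_det _ b
  · rw [← Basis.det_apply]
    exact Basis.isUnit_det _ _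
  · rw [← hP, basis_toMatrix_mul_linearMap_toMatrix_mul_basis_toMatrix,
      LinearMap.toMatrix_eq_toMatrix', LinearMap.toMatrix'_toLin']

theorem finrank_ker_comp_le {K V V' V'' : Type*} [DivisionRing K] [AddCommGroup V] [Module K V]
    [AddCommGroup V'] [Module K V'] [AddCommGroup V''] [Module K V'']
    [FiniteDimensional K V] [FiniteDimensional K V'] (f : V' →ₗ[K] V'') (g : V →ₗ[K] V') :
    finrank K (LinearMap.ker (f ∘ₗ g)) ≤
      finrank K (LinearMap.ker f) + finrank K (LinearMap.ker g) := by
  let h : LinearMap.ker (f ∘ₗ g) →ₗ[K] LinearMap.ker f :=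
    (g.domRestrict _).codRestrict _ fun x => x.2
  have hker : finrank K (LinearMap.ker h) ≤ finrank K (LinearMap.ker g) :=
    LinearMap.finrank_le_finrank_of_injective
      (f := ((Submodule.subtype _ ∘ₗ Submodule.subtype _).codRestrict (LinearMap.ker g)
        fun x => congrArg Subtype.val x.2 : LinearMap.ker h →ₗ[K] _))
      fun x y hxy => Subtype.ext (Subtype.ext (congrArg (fun z : LinearMap.ker g => (z : V)) hxy))
  rw [← h.finrank_range_add_finrank_ker]
  exact Nat.add_le_add (Submodule.finrank_le _) hker

variable {K : Type*} [Field K]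

theorem finrank_ker_prod_le {V ι : Type*} [AddCommGroup V] [Module K V] [FiniteDimensional K V]
    (f : Module.End K V) (s : Finset ι) (a : ι → K[X]) :
    finrank K (LinearMap.ker (aeval f (∏ i ∈ s, a i))) ≤
      ∑ i ∈ s, finrank K (LinearMap.ker (aeval f (a i))) := by
  classical
  induction s using Finset.induction_on with
  | empty =>
    rw [Finset.prod_empty, map_one, Module.End.one_eq_id, LinearMap.ker_id, finrank_bot]
    exact Nat.zero_le _
  | insert i s hi ih =>
    rw [Finset.prod_insert hi, Finset.sum_insert hi, map_mul, Module.End.mul_eq_comp]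
    exact (finrank_ker_comp_le _ _).trans (Nat.add_le_add_left ih _)

variable {ι κ : Type*} [Fintype ι] [DecidableEq ι] [Fintype κ]

theorem sum_finrank_ker_le_finrank_ker_blockDiagonal (M : ι → Matrix κ κ K) :
    ∑ i, finrank K (LinearMap.ker (M i).mulVecLin) ≤
      finrank K (LinearMap.ker (Matrix.blockDiagonal M).mulVecLin) := by
  rw [← finrank_pi_fintype]
  let L : (∀ i, LinearMap.ker (M i).mulVecLin) →ₗ[K] (κ × ι → K) :=
    { toFun := fun x p => (x p.2 : κ → K) p.1
      map_add' := fun x y => rfl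
      map_smul' := fun c x => rfl }
  have hL : ∀ x, (Matrix.blockDiagonal M).mulVecLin (L x) = 0 := fun x => by
    ext ⟨c, i⟩
    have hx : ∑ d, M i c d * (x i : κ → K) d = 0 := congrFun (LinearMap.mem_ker.1 (x i).2) c
    simpa [L, Matrix.mulVec, dotProduct, Matrix.blockDiagonal_apply, Fintype.sum_prod_type]
      using hx
  exact LinearMap.finrank_le_finrank_of_injective (f := L.codRestrict _ hL) fun x y hxy =>
    funext fun i => Subtype.ext (funext fun c => congrFun (congrArg Subtype.val hxy) (c, i))

variable [DecidableEq κ]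

/-- Substitution of a matrix `D` for the variable of a polynomial matrix `P`: the entry `P i j`
becomes the block `(P i j)(D)` with row indices `(·, i)` and column indices `(·, j)`. -/
noncomputable def substHom (D : Matrix κ κ K) :
    Matrix ι ι K[X] →+* Matrix (κ × ι) (κ × ι) K :=
  (Matrix.reindexAlgEquiv K K (Equiv.prodComm ι κ)).toRingEquiv.toRingHom.comp
    ((Matrix.compRingEquiv ι κ K).toRingHom.comp (aeval D : K[X] →ₐ[K] _).toRingHom.mapMatrix)

theorem substHom_apply (D : Matrix κ κ K) (P : Matrix ι ι K[X]) (x y : κ × ι) :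
    substHom D P x y = aeval D (P x.2 y.2) x.1 y.1 := rfl

theorem substHom_diagonal (D : Matrix κ κ K) (a : ι → K[X]) :
    substHom D (Matrix.diagonal a) = Matrix.blockDiagonal fun i => aeval D (a i) := by
  ext x y
  rw [substHom_apply, Matrix.diagonal_apply, Matrix.blockDiagonal_apply]
  split_ifs <;> simp

theorem card_le_finrank_ker_substHom_diagonal (D : Matrix κ κ K) {a : ι → K[X]}
    (ha : aeval D (∏ i, a i) = 0) :
    Fintype.card κ ≤ finrank K (LinearMap.ker (substHom D (Matrix.diagonal a)).mulVecLin) := by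
  have hlin : ∀ p : K[X], aeval (Matrix.toLin' D) p = (aeval D p).mulVecLin := fun p =>
    aeval_algHom_apply (Matrix.toLinAlgEquiv' : _ ≃ₐ[K] _) D p
  have hprod := finrank_ker_prod_le (Matrix.toLin' D) Finset.univ a
  rw [hlin, ha, Matrix.mulVecLin_zero, LinearMap.ker_zero, finrank_top,
    finrank_fintype_fun_eq_card] at hprod
  rw [substHom_diagonal]
  refine hprod.trans ((Finset.sum_congr rfl fun i _ => ?_).trans_le
    (sum_finrank_ker_le_finrank_ker_blockDiagonal _))
  rw [hlin]

theorem rank_substHom_add_card_le (D : Matrix κ κ K) {P : Matrix ι ι K[X]} (hP : P.det ≠ 0)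
    (hD : aeval D P.det = 0) :
    (substHom D P).rank + Fintype.card κ ≤ Fintype.card (κ × ι) := by
  obtain ⟨E, F, a, hE, hF, rfl⟩ := exists_smith_form hP
  have hunit : ∀ G : Matrix ι ι K[X], IsUnit G.det → IsUnit (substHom D G).det := fun G hG =>
    (Matrix.isUnit_iff_isUnit_det _).1 (((Matrix.isUnit_iff_isUnit_det G).2 hG).map _)
  have hprod : aeval D (∏ i, a i) = 0 := by
    rw [Matrix.det_mul, Matrix.det_mul, Matrix.det_diagonal, mul_right_comm, map_mul] at hD
    exact ((hE.mul hF).map (aeval D)).mul_right_eq_zero.1 hD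
  rw [map_mul, map_mul, Matrix.rank_mul_eq_left_of_isUnit_det _ _ (hunit F hF),
    Matrix.rank_mul_eq_right_of_isUnit_det _ _ (hunit E hE)]
  refine (Nat.add_le_add_left (card_le_finrank_ker_substHom_diagonal D hprod) _).trans_eq ?_
  rw [Matrix.rank, LinearMap.finrank_range_add_finrank_ker, finrank_fintype_fun_eq_card]

end Nullity

section Vec

variable {ι κ : Type*} [Fintype ι] [Fintype κ]

theorem norm_sq_toLp_vec (X : Matrix ι κ ℂ) :
    ‖WithLp.toLp 2 X.vec‖ ^ 2 = ∑ c, ‖WithLp.toLp 2 (X.col c)‖ ^ 2 := by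
  simp only [EuclideanSpace.norm_sq_eq, Fintype.sum_prod_type]
  rfl

variable [DecidableEq ι]

theorem norm_toLp_vec_mul_le (Δ : Matrix ι ι ℂ) (X : Matrix ι κ ℂ) :
    ‖WithLp.toLp 2 (Δ * X).vec‖ ≤ ‖Δ‖ * ‖WithLp.toLp 2 X.vec‖ := by
  refine le_of_sq_le_sq ?_ (by positivity)
  rw [mul_pow, norm_sq_toLp_vec, norm_sq_toLp_vec, Finset.mul_sum]
  refine Finset.sum_le_sum fun c _ => ?_
  rw [← mul_pow]
  exact pow_le_pow_left₀ (norm_nonneg _) (Matrix.l2_opNorm_mulVec Δ (WithLp.toLp 2 (X.col c))) 2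

theorem norm_one_kronecker_le [DecidableEq κ] (Δ : Matrix ι ι ℂ) :
    ‖(1 : Matrix κ κ ℂ) ⊗ₖ Δ‖ ≤ ‖Δ‖ := by
  rw [Matrix.l2_opNorm_def]
  refine ContinuousLinearMap.opNorm_le_bound _ (norm_nonneg _) fun x => ?_
  have h := norm_toLp_vec_mul_le Δ (Matrix.of fun i c => x.ofLp (c, i))
  rwa [← Matrix.mul_one (Δ * _), ← Matrix.transpose_one, ← Matrix.kronecker_mulVec_vec] at h

end Vec

section LowerBound

theorem sigmaNeg_le_norm_of_rank_add_le {ι : Type} [Fintype ι] [DecidableEq ι] {k : ℕ}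
    {B Δ : Matrix ι ι ℂ} (h : (B + Δ).rank + k ≤ Fintype.card ι) : sigmaNeg k B ≤ ‖Δ‖ := by
  have hnullity := LinearMap.finrank_range_add_finrank_ker (Matrix.toEuclideanLin (B + Δ))
  rw [Matrix.toEuclideanLin_eq_toLin_orthonormal, ← Matrix.rank_eq_finrank_range_toLin,
    ← Matrix.toEuclideanLin_eq_toLin_orthonormal, finrank_euclideanSpace] at hnullity
  refine singularValues_le_of_subspace _ (norm_nonneg _)
    (LinearMap.ker (Matrix.toEuclideanLin (B + Δ))) (by rw [finrank_euclideanSpace]; omega)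
    fun x hx => ?_
  rw [LinearMap.mem_ker, map_add, LinearMap.add_apply] at hx
  rw [eq_neg_of_add_eq_zero_left hx, norm_neg]
  exact Matrix.l2_opNorm_mulVec Δ x

variable {n m r : ℕ} (A : Fin (m + 1) → Matrix (Fin n) (Fin n) ℂ)

theorem matPoly_add_map_C (Δ : Matrix (Fin n) (Fin n) ℂ) :
    matPoly A + Δ.map C = matPoly (A + Pi.single 0 Δ) := by
  simp only [matPoly, Pi.add_apply, Matrix.map_add C (map_add C), smul_add, Finset.sum_add_distrib]
  rw [add_right_inj, Finset.sum_eq_single 0 (fun j _ hj => ?_) (by simp), Pi.single_eq_same,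
    Fin.val_zero, pow_zero, one_smul]
  rw [Pi.single_eq_of_ne hj, Matrix.map_zero C C.map_zero, smul_zero]

theorem Qmat_add_single (μ : Fin r → ℂ) (Γ : StrictUpper r → ℂ) (Δ : Matrix (Fin n) (Fin n) ℂ) :
    Qmat (A + Pi.single 0 Δ) μ Γ = Qmat A μ Γ + 1 ⊗ₖ Δ := by
  simp only [Qmat, Pi.add_apply, Matrix.kronecker_add, Finset.sum_add_distrib]
  rw [add_right_inj, Finset.sum_eq_single 0 (fun j _ hj => ?_) (by simp), Pi.single_eq_same,
    Fin.val_zero, pow_zero, Matrix.transpose_one]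
  rw [Pi.single_eq_of_ne hj, Matrix.kronecker_zero]

theorem substHom_matPoly (μ : Fin r → ℂ) (Γ : StrictUpper r → ℂ) :
    substHom (Cmat μ Γ)ᵀ (matPoly A) = Qmat A μ Γ := by
  ext ⟨c, i⟩ ⟨d, j⟩
  simp only [substHom_apply, matPoly, Qmat, Matrix.sum_apply, map_sum, Matrix.smul_apply,
    Matrix.map_apply, smul_eq_mul, map_mul, map_pow, aeval_X, aeval_C, Matrix.kroneckerMap_apply,
    Matrix.transpose_pow]
  refine Finset.sum_congr rfl fun k _ => ?_
  rw [Matrix.algebraMap_eq_diagonal, Matrix.mul_diagonal]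
  rfl

theorem isUpperTriangular_Cmat (μ : Fin r → ℂ) (Γ : StrictUpper r → ℂ) :
    (Cmat μ Γ).IsUpperTriangular := fun i j (hji : j < i) => by simp [Cmat, hji.ne', hji.not_gt]

theorem charpoly_Cmat (μ : Fin r → ℂ) (Γ : StrictUpper r → ℂ) :
    (Cmat μ Γ).charpoly = ∏ i, (X - C (μ i)) := by
  rw [Matrix.charpoly_of_isUpperTriangular _ (isUpperTriangular_Cmat μ Γ)]
  simp [Cmat]

variable {A} in
theorem sigmaNeg_Qmat_le_norm2 {Δ : Matrix (Fin n) (Fin n) ℂ} {ν : Fin r → ℂ}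
    (hdet : (matPoly A + Δ.map C).det ≠ 0) (hν : ∏ i, (X - C (ν i)) ∣ (matPoly A + Δ.map C).det)
    (Γ : StrictUpper r → ℂ) : sigmaNeg r (Qmat A ν Γ) ≤ norm2 Δ := by
  refine le_trans (sigmaNeg_le_norm_of_rank_add_le ?_) (norm_one_kronecker_le Δ)
  have hann : aeval (Cmat ν Γ)ᵀ (matPoly A + Δ.map C).det = 0 := by
    rw [← charpoly_Cmat ν Γ, ← Matrix.charpoly_transpose] at hν
    obtain ⟨q, hq⟩ := hν
    rw [hq, map_mul, Matrix.aeval_self_charpoly, zero_mul]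
  have hrank := rank_substHom_add_card_le _ hdet hann
  rwa [matPoly_add_map_C, substHom_matPoly, Qmat_add_single, Fintype.card_fin] at hrank

theorem feasible_iff {S : Finset ℂ} {Δ : Matrix (Fin n) (Fin n) ℂ}
    (hdet : (matPoly A + Δ.map C).det ≠ 0) : Feasible A S r Δ ↔
      ∃ ν : Fin r → ℂ, (∀ i, ν i ∈ S) ∧ ∏ i, (X - C (ν i)) ∣ (matPoly A + Δ.map C).det :=
  le_sum_rootMultiplicity_iff hdet

end LowerBound

section Determinant

variable {ι κ R : Type*} [Fintype ι] [DecidableEq ι] [CommRing R]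

theorem coeff_det_card_mul {M : Matrix ι ι R[X]} {d : ℕ} (hM : ∀ i j, (M i j).natDegree ≤ d) :
    M.det.coeff (Fintype.card ι * d) = (M.map fun p => p.coeff d).det := by
  simp only [Matrix.det_apply', finsetSum_coeff, ← map_intCast (C : R →+* R[X]), coeff_C_mul]
  refine Finset.sum_congr rfl fun σ _ => congrArg _ ?_
  rw [Fintype.card, coeff_prod_of_natDegree_le _ _ d fun i _ => hM _ i]
  rfl

theorem det_dvd_det_of_mul_eq_mul [Fintype κ] [DecidableEq κ] {P : Matrix ι ι R}
    {V G : Matrix ι κ R} {L : Matrix κ κ R} {W : Matrix κ ι R} (hWV : W * V = 1)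
    (h : P * V = G * L) : L.det ∣ P.det := by
  -- `P` acts as `G L W` on the range of `V W` and is kept on the kernel of `W`.
  let H : Matrix ι ι R := 1 + V * ((L - 1) * W)
  have hdet : H.det = L.det := by
    rw [Matrix.det_one_add_mul_comm, Matrix.mul_assoc, hWV, Matrix.mul_one, add_sub_cancel]
  have hWH : W * H = L * W := by
    rw [Matrix.mul_add, Matrix.mul_one, ← Matrix.mul_assoc, hWV, Matrix.one_mul, Matrix.sub_mul,
      Matrix.one_mul, add_sub_cancel]
  have hfactor : P = (G * W + P * (1 - V * W)) * H := by
    have hproj : (1 - V * W) * H = 1 - V * W := by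
      rw [Matrix.sub_mul, Matrix.one_mul, Matrix.mul_assoc, hWH]
      simp only [H, Matrix.sub_mul, Matrix.one_mul, Matrix.mul_sub]
      abel
    rw [Matrix.add_mul, Matrix.mul_assoc, hWH, Matrix.mul_assoc, hproj, ← Matrix.mul_assoc, ← h,
      Matrix.mul_sub, Matrix.mul_one, Matrix.mul_assoc, add_sub_cancel]
  rw [hfactor, Matrix.det_mul, hdet]
  exact dvd_mul_left _ _

end Determinant

section InvariantPair

theorem isUnit_det_of_rank_eq_card {ι K : Type*} [Fintype ι] [DecidableEq ι] [Field K]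
    {B : Matrix ι ι K} (hB : B.rank = Fintype.card ι) : IsUnit B.det := by
  rw [← Matrix.isUnit_iff_isUnit_det, ← Matrix.linearIndependent_cols_iff_isUnit,
    linearIndependent_iff_card_eq_finrank_span, Set.finrank, ← Matrix.rank_eq_finrank_span_cols, hB]

variable {n m r : ℕ}

theorem matPoly_apply (A : Fin (m + 1) → Matrix (Fin n) (Fin n) ℂ) (a b : Fin n) :
    matPoly A a b = ∑ j : Fin (m + 1), C (A j a b) * X ^ (j : ℕ) := by
  simp only [matPoly, Matrix.sum_apply, Matrix.smul_apply, Matrix.map_apply, smul_eq_mul,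
    X_pow_mul_C]

theorem det_matPoly_ne_zero {A : Fin (m + 1) → Matrix (Fin n) (Fin n) ℂ}
    (hA : (A (Fin.last m)).rank = n) : (matPoly A).det ≠ 0 := by
  have hdeg : ∀ a b, (matPoly A a b).natDegree ≤ m := fun a b => by
    rw [matPoly_apply]
    exact natDegree_sum_le_of_forall_le _ _ fun j _ =>
      (natDegree_C_mul_X_pow_le _ _).trans (Nat.lt_succ_iff.1 j.2)
  have hlead : (matPoly A).map (fun p => p.coeff m) = A (Fin.last m) := by
    ext a b
    simp only [Matrix.map_apply, matPoly_apply, finsetSum_coeff, coeff_C_mul_X_pow]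
    rw [Finset.sum_eq_single (Fin.last m) (fun j _ hj => if_neg fun h => hj (Fin.ext h.symm))
      (by simp), if_pos (Fin.val_last m).symm]
  intro h0
  have hdet := coeff_det_card_mul hdeg
  rw [h0, coeff_zero, hlead] at hdet
  refine (isUnit_det_of_rank_eq_card ?_).ne_zero hdet.symm
  rw [hA, Fintype.card_fin]

theorem det_matPoly_add_map_C_ne_zero (hm : 0 < m) {A : Fin (m + 1) → Matrix (Fin n) (Fin n) ℂ}
    (hA : (A (Fin.last m)).rank = n) (Δ : Matrix (Fin n) (Fin n) ℂ) :
    (matPoly A + Δ.map C).det ≠ 0 := by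
  rw [matPoly_add_map_C]
  refine det_matPoly_ne_zero ?_
  rwa [Pi.add_apply, Pi.single_eq_of_ne (Fin.ne_of_gt hm), add_zero]

theorem pinv_mul_self {V : Matrix (Fin n) (Fin r) ℂ} (hV : V.rank = r) : pinv V * V = 1 := by
  open scoped ComplexOrder in
  have hunit : IsUnit (Vᴴ * V).det := isUnit_det_of_rank_eq_card <| by
    rw [Matrix.rank_conjTranspose_mul_self, hV, Fintype.card_fin]
  rw [pinv, Matrix.mul_assoc, Matrix.nonsing_inv_mul _ hunit]

theorem exists_matPoly_mul_eq_mul_charmatrix {A : Fin (m + 1) → Matrix (Fin n) (Fin n) ℂ}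
    {V : Matrix (Fin n) (Fin r) ℂ} {K : Matrix (Fin r) (Fin r) ℂ}
    (h : ∑ j : Fin (m + 1), A j * V * K ^ (j : ℕ) = 0) :
    ∃ G : Matrix (Fin n) (Fin r) ℂ[X], matPoly A * V.map C = G * K.charmatrix := by
  let x : Matrix (Fin r) (Fin r) ℂ[X] := Matrix.scalar (Fin r) X
  have hcomm : Commute x (K.map C) := Matrix.scalar_commute _ (fun _ => Commute.all _ _) _
  have hvalue : ∑ j : Fin (m + 1), (A j * V).map C * K.map C ^ (j : ℕ) = 0 := by
    have hmap : ∀ j : ℕ, K.map C ^ j = (K ^ j).map C := fun j => (map_pow C.mapMatrix K j).symm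
    simp only [hmap, ← Matrix.map_mul]
    rw [← Matrix.map_zero C C.map_zero, ← h]
    exact (map_sum (C : ℂ →+* ℂ[X]).toAddMonoidHom.mapMatrix _ _).symm
  have hpoly : matPoly A * V.map C = ∑ j : Fin (m + 1), (A j * V).map C * x ^ (j : ℕ) := by
    rw [matPoly, Matrix.sum_mul]
    refine Finset.sum_congr rfl fun j _ => ?_
    rw [← map_pow, Matrix.scalar_apply, ← Matrix.smul_eq_mul_diagonal, Matrix.map_mul,
      Matrix.smul_mul]
  refine ⟨∑ j : Fin (m + 1), (A j * V).map C *
    ∑ i ∈ Finset.range j, x ^ i * K.map C ^ ((j : ℕ) - 1 - i), ?_⟩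
  rw [← sub_zero (matPoly A * _), ← hvalue, hpoly, ← Finset.sum_sub_distrib, Matrix.sum_mul]
  refine Finset.sum_congr rfl fun j _ => ?_
  rw [Matrix.mul_assoc, Matrix.charmatrix, RingHom.mapMatrix_apply, hcomm.geom_sum₂_mul,
    Matrix.mul_sub]

theorem sum_kronecker_mulVec_vec (A : Fin (m + 1) → Matrix (Fin n) (Fin n) ℂ)
    (Y : Fin (m + 1) → Matrix (Fin r) (Fin r) ℂ) (V : Matrix (Fin n) (Fin r) ℂ) :
    (∑ j, (Y j)ᵀ ⊗ₖ A j) *ᵥ V.vec = (∑ j, A j * V * Y j).vec := by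
  rw [Matrix.sum_mulVec, Matrix.vec_sum]
  refine Finset.sum_congr rfl fun j _ => ?_
  rw [Matrix.kronecker_mulVec_vec, Matrix.transpose_transpose]

theorem prod_dvd_det_matPoly {A : Fin (m + 1) → Matrix (Fin n) (Fin n) ℂ} {μ : Fin r → ℂ}
    {Γ : StrictUpper r → ℂ} {V : Matrix (Fin n) (Fin r) ℂ} (hV : V.rank = r)
    (h : Qmat A μ Γ *ᵥ V.vec = 0) : ∏ i, (X - C (μ i)) ∣ (matPoly A).det := by
  rw [Qmat, sum_kronecker_mulVec_vec, Matrix.vec_eq_zero_iff] at h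
  obtain ⟨G, hG⟩ := exists_matPoly_mul_eq_mul_charmatrix h
  rw [← charpoly_Cmat μ Γ]
  refine det_dvd_det_of_mul_eq_mul (W := (pinv V).map C) ?_ hG
  rw [← Matrix.map_mul, pinv_mul_self hV, Matrix.map_one _ C.map_zero C.map_one]

end InvariantPair

section PowDeriv

/-- The derivative of the `j`-th power at `x` in the direction `e`, in a noncommutative ring. -/
def powDeriv {R : Type*} [Semiring R] (x e : R) (j : ℕ) : R :=
  ∑ i ∈ Finset.range j, x ^ (j - 1 - i) * e * x ^ i

theorem powDeriv_mul_sub_mul_powDeriv {R : Type*} [Ring R] (x e : R) (j : ℕ) :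
    powDeriv x e j * x - x * powDeriv x e j = e * x ^ j - x ^ j * e := by
  have htelescope := Finset.sum_range_sub (fun i => x ^ (j - i) * e * x ^ i) j
  simp only [Nat.sub_self, Nat.sub_zero, pow_zero, one_mul, mul_one] at htelescope
  rw [← htelescope, powDeriv, Finset.sum_mul, Finset.mul_sum, ← Finset.sum_sub_distrib]
  refine Finset.sum_congr rfl fun i hi => ?_
  have hsucc : j - (i + 1) = j - 1 - i := by omega
  have hi' : j - i = j - 1 - i + 1 := by grind
  rw [hsucc, hi', pow_succ' x (j - 1 - i), pow_succ x i]
  simp only [mul_assoc]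

theorem trace_powDeriv_mul {ι R : Type*} [Fintype ι] [DecidableEq ι] [CommSemiring R]
    (x a e : Matrix ι ι R) (j : ℕ) :
    (powDeriv x a j * e).trace = (a * powDeriv x e j).trace := by
  rw [powDeriv, powDeriv, ← Finset.sum_range_reflect, Finset.sum_mul, Finset.mul_sum,
    Matrix.trace_sum, Matrix.trace_sum]
  refine Finset.sum_congr rfl fun i hi => ?_
  have hi' : j - 1 - (j - 1 - i) = i := by grind
  rw [hi', Matrix.mul_assoc, Matrix.mul_assoc, Matrix.trace_mul_comm]
  simp only [Matrix.mul_assoc]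

end PowDeriv

section Stationarity

variable {n m r : ℕ} (A : Fin (m + 1) → Matrix (Fin n) (Fin n) ℂ)

/-- The gradient `M` of `K ↦ tr (Uᴴ ∑ⱼ Aⱼ V Kʲ)`, whose derivative in the direction `E` is
`tr (M E)`. -/
def traceGrad (K : Matrix (Fin r) (Fin r) ℂ) (U V : Matrix (Fin n) (Fin r) ℂ) :
    Matrix (Fin r) (Fin r) ℂ :=
  ∑ j : Fin (m + 1), powDeriv K (Uᴴ * A j * V) j

theorem traceGrad_mul_sub_mul_traceGrad (K : Matrix (Fin r) (Fin r) ℂ)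
    (U V : Matrix (Fin n) (Fin r) ℂ) :
    traceGrad A K U V * K - K * traceGrad A K U V =
      Uᴴ * ∑ j : Fin (m + 1), A j * V * K ^ (j : ℕ) -
        (∑ j : Fin (m + 1), K ^ (j : ℕ) * Uᴴ * A j) * V := by
  simp only [traceGrad, Matrix.sum_mul, Matrix.mul_sum, ← Finset.sum_sub_distrib,
    powDeriv_mul_sub_mul_powDeriv, Matrix.mul_assoc]

theorem star_vec_dotProduct_mulVec_powDeriv (K E : Matrix (Fin r) (Fin r) ℂ)
    (U V : Matrix (Fin n) (Fin r) ℂ) :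
    star U.vec ⬝ᵥ ((∑ j : Fin (m + 1), (powDeriv K E j)ᵀ ⊗ₖ A j) *ᵥ V.vec) =
      (traceGrad A K U V * E).trace := by
  rw [sum_kronecker_mulVec_vec A fun j => powDeriv K E j, Matrix.star_vec_dotProduct_vec,
    Matrix.mul_sum, Matrix.trace_sum, traceGrad, Matrix.sum_mul, Matrix.trace_sum]
  refine Finset.sum_congr rfl fun j _ => ?_
  rw [trace_powDeriv_mul]
  simp only [Matrix.mul_assoc]

theorem hasDerivAt_sum_kronecker {f : Fin (m + 1) → ℝ → Matrix (Fin r) (Fin r) ℂ}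
    {f' : Fin (m + 1) → Matrix (Fin r) (Fin r) ℂ} {t : ℝ} (hf : ∀ j, HasDerivAt (f j) (f' j) t) :
    HasDerivAt (fun t => Matrix.toEuclideanCLM (𝕜 := ℂ) (∑ j, (f j t)ᵀ ⊗ₖ A j))
      (Matrix.toEuclideanCLM (𝕜 := ℂ) (∑ j, (f' j)ᵀ ⊗ₖ A j)) t := by
  let L : (Fin (m + 1) → Matrix (Fin r) (Fin r) ℂ) →ₗ[ℝ]
      (EuclideanSpace ℂ (Fin r × Fin n) →L[ℂ] EuclideanSpace ℂ (Fin r × Fin n)) :=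
    { toFun := fun Y => Matrix.toEuclideanCLM (𝕜 := ℂ) (∑ j, (Y j)ᵀ ⊗ₖ A j)
      map_add' := fun Y Z => by
        simp only [Pi.add_apply, Matrix.transpose_add, Matrix.add_kronecker,
          Finset.sum_add_distrib, map_add]
      map_smul' := fun c Y => by
        simp only [← Complex.coe_smul, Pi.smul_apply, Matrix.transpose_smul, Matrix.smul_kronecker,
          ← Finset.smul_sum, map_smul, RingHom.id_apply] }
  exact L.toContinuousLinearMap.hasFDerivAt.comp_hasDerivAt t (hasDerivAt_pi.2 hf)

theorem Cmat_add_single (μ : Fin r → ℂ) (Γ : StrictUpper r → ℂ) (p : StrictUpper r) (c : ℂ) :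
    Cmat μ (Γ + Pi.single p c) = Cmat μ Γ + c • Matrix.single p.1.1 p.1.2 1 := by
  obtain ⟨⟨i, k⟩, hik⟩ := p
  ext a b
  simp only [Cmat, Matrix.of_apply, Matrix.add_apply, Matrix.smul_apply, Matrix.single_apply,
    Pi.add_apply, Pi.single_apply, Subtype.mk.injEq, Prod.mk.injEq, smul_eq_mul]
  grind

theorem hasDerivAt_Qmat_add_single (μ : Fin r → ℂ) (Γ : StrictUpper r → ℂ) (p : StrictUpper r)
    (θ : ℂ) :
    HasDerivAt (fun t : ℝ => Matrix.toEuclideanCLM (𝕜 := ℂ) (Qmat A μ (Γ + Pi.single p (t * θ))))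
      (Matrix.toEuclideanCLM (𝕜 := ℂ) (∑ j : Fin (m + 1),
        (powDeriv (Cmat μ Γ) (θ • Matrix.single p.1.1 p.1.2 1) j)ᵀ ⊗ₖ A j)) 0 := by
  let E : Matrix (Fin r) (Fin r) ℂ := θ • Matrix.single p.1.1 p.1.2 1
  have hline : HasDerivAt (fun t : ℝ => Cmat μ Γ + t • E) E 0 := by
    simpa using ((hasDerivAt_id (0 : ℝ)).smul_const E).const_add (Cmat μ Γ)
  have hpow : ∀ j : Fin (m + 1), HasDerivAt (fun t : ℝ => (Cmat μ Γ + t • E) ^ (j : ℕ))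
      (powDeriv (Cmat μ Γ) E j) 0 := fun j => by
    simpa only [powDeriv, Nat.pred_eq_sub_one, zero_smul, add_zero] using hline.fun_pow' j
  simpa only [Qmat, Cmat_add_single, mul_smul, Complex.coe_smul] using
    hasDerivAt_sum_kronecker A hpow

end Stationarity

section Commutator

variable {ι R : Type*} [Fintype ι] [LinearOrder ι] [CommRing R] {K B : Matrix ι ι R}

theorem mul_apply_self_of_isUpperTriangular (hK : K.IsUpperTriangular)
    (hB : B.IsUpperTriangular) (i : ι) : (K * B) i i = K i i * B i i :=
  Finset.sum_eq_single i (fun l _ hl => hl.lt_or_gt.elim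
    (fun h => mul_eq_zero_of_left (hK h) _) (fun h => mul_eq_zero_of_right _ (hB h))) (by simp)

theorem commutator_apply_eq_zero (hK : K.IsUpperTriangular) (hB : B.IsUpperTriangular) {i j : ι}
    (hji : j ≤ i) : (K * B - B * K) i j = 0 := by
  rcases hji.lt_or_eq with hlt | rfl
  · exact ((hK.mul hB).sub (hB.mul hK)) hlt
  · rw [Matrix.sub_apply, mul_apply_self_of_isUpperTriangular hK hB,
      mul_apply_self_of_isUpperTriangular hB hK, mul_comm, sub_self]

end Commutator

section Gram

variable {n m r : ℕ}

theorem isSimpleSingularValue_of_singValMult_eq_one {ι : Type} [Fintype ι] [DecidableEq ι]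
    {B : Matrix ι ι ℂ} {q : ℕ} (hq : q < Fintype.card ι) (h : singValMult B (singVal B q) = 1) :
    IsSimpleSingularValue (Matrix.toEuclideanLin B) q := by
  obtain ⟨a, ha⟩ := Set.ncard_eq_one.1 h
  have hmem : ∀ i < Fintype.card ι, singVal B i = singVal B q → i = a := fun i hi he =>
    ha.subset ⟨hi, he⟩
  rw [IsSimpleSingularValue, finrank_euclideanSpace]
  exact ⟨hq, fun i hi he => (hmem i hi he).trans (hmem q hq rfl).symm⟩

theorem SingularPair.card_sub_lt {Q : Matrix (Fin r × Fin n) (Fin r × Fin n) ℂ} {s : ℝ}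
    {U V : Matrix (Fin n) (Fin r) ℂ} (h : SingularPair Q s U V) :
    Fintype.card (Fin r × Fin n) - r < Fintype.card (Fin r × Fin n) := by
  rcases isEmpty_or_nonempty (Fin r × Fin n) with hempty | hne
  · have hV := h.2.1
    rw [Subsingleton.elim (WithLp.toLp 2 V.vec) 0, norm_zero] at hV
    exact absurd hV zero_ne_one
  · exact Nat.sub_lt Fintype.card_pos hne.some.1.pos

theorem SingularPair.apply_right {Q : Matrix (Fin r × Fin n) (Fin r × Fin n) ℂ} {s : ℝ}
    {U V : Matrix (Fin n) (Fin r) ℂ} (h : SingularPair Q s U V) :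
    Matrix.toEuclideanLin Q (WithLp.toLp 2 V.vec) = (s : ℂ) • WithLp.toLp 2 U.vec :=
  congrArg (WithLp.toLp 2) h.2.2.1

theorem SingularPair.adjoint_apply {Q : Matrix (Fin r × Fin n) (Fin r × Fin n) ℂ} {s : ℝ}
    {U V : Matrix (Fin n) (Fin r) ℂ} (h : SingularPair Q s U V) :
    LinearMap.adjoint (Matrix.toEuclideanLin Q) (Matrix.toEuclideanLin Q (WithLp.toLp 2 V.vec)) =
      ((s ^ 2 : ℝ) : ℂ) • WithLp.toLp 2 V.vec := by
  have hleft : Qᴴ *ᵥ U.vec = (s : ℂ) • V.vec := by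
    rw [← star_inj, Matrix.star_mulVec, Matrix.conjTranspose_conjTranspose, h.2.2.2, star_smul,
      Complex.star_def, Complex.conj_ofReal]
  rw [h.apply_right, map_smul, ← Matrix.toEuclideanLin_conjTranspose_eq_adjoint, pow_two,
    Complex.ofReal_mul, mul_smul]
  exact congrArg _ (congrArg (WithLp.toLp 2) hleft)

theorem SingularPair.mul_re_star_dotProduct_mulVec_deriv_eq_zero
    {Q : ℝ → Matrix (Fin r × Fin n) (Fin r × Fin n) ℂ}
    {Q' : Matrix (Fin r × Fin n) (Fin r × Fin n) ℂ} {U V : Matrix (Fin n) (Fin r) ℂ}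
    (hpair : SingularPair (Q 0) (sigmaNeg r (Q 0)) U V)
    (hmult : singValMult (Q 0) (sigmaNeg r (Q 0)) = 1)
    (hderiv : HasDerivAt (fun t => Matrix.toEuclideanCLM (𝕜 := ℂ) (Q t))
      (Matrix.toEuclideanCLM (𝕜 := ℂ) Q') 0)
    (hmax : ∀ t, sigmaNeg r (Q t) ≤ sigmaNeg r (Q 0)) :
    sigmaNeg r (Q 0) * (star U.vec ⬝ᵥ (Q' *ᵥ V.vec)).re = 0 := by
  have hsimple := isSimpleSingularValue_of_singValMult_eq_one hpair.card_sub_lt hmult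
  have hright := hpair.apply_right
  have hadjoint := hpair.adjoint_apply
  simp only [sigmaNeg, singVal, ← Matrix.coe_toEuclideanCLM_eq_toEuclideanLin] at *
  have hstat := IsSimpleSingularValue.re_inner_deriv_eq_zero hderiv hsimple hmax hadjoint
  rw [← ContinuousLinearMap.coe_coe (Matrix.toEuclideanCLM (𝕜 := ℂ) (Q 0)), hright,
    inner_smul_left, Complex.conj_ofReal, Complex.re_ofReal_mul, Matrix.toEuclideanCLM_toLp,
    EuclideanSpace.inner_toLp_toLp, dotProduct_comm] at hstat
  exact hstat

variable {A : Fin (m + 1) → Matrix (Fin n) (Fin n) ℂ} {μ : Fin r → ℂ} {Γ : StrictUpper r → ℂ}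
  {U V : Matrix (Fin n) (Fin r) ℂ}

theorem traceGrad_apply_eq_zero
    (hmax : ∀ Γ', sigmaNeg r (Qmat A μ Γ') ≤ sigmaNeg r (Qmat A μ Γ))
    (hpair : SingularPair (Qmat A μ Γ) (sigmaNeg r (Qmat A μ Γ)) U V)
    (hmult : singValMult (Qmat A μ Γ) (sigmaNeg r (Qmat A μ Γ)) = 1)
    (hpos : 0 < sigmaNeg r (Qmat A μ Γ)) {i k : Fin r} (hik : i < k) :
    traceGrad A (Cmat μ Γ) U V k i = 0 := by
  let θ := star (traceGrad A (Cmat μ Γ) U V k i)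
  let Q : ℝ → Matrix (Fin r × Fin n) (Fin r × Fin n) ℂ := fun t =>
    Qmat A μ (Γ + Pi.single ⟨(i, k), hik⟩ (t * θ))
  have hQ : Q 0 = Qmat A μ Γ := by
    simp only [Q, Complex.ofReal_zero, zero_mul, Pi.single_zero, add_zero]
  have hstat := SingularPair.mul_re_star_dotProduct_mulVec_deriv_eq_zero (Q := Q)
    (by rwa [hQ]) (by rwa [hQ]) (hasDerivAt_Qmat_add_single A μ Γ ⟨(i, k), hik⟩ θ)
    (fun t => by rw [hQ]; exact hmax _)
  rw [hQ, star_vec_dotProduct_mulVec_powDeriv, Matrix.mul_smul, Matrix.trace_smul,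
    Matrix.trace_mul_comm, Matrix.trace_single_mul, one_smul, smul_eq_mul] at hstat
  change _ * (star (traceGrad A (Cmat μ Γ) U V k i) * traceGrad A (Cmat μ Γ) U V k i).re = 0
    at hstat
  rw [Complex.star_def, ← Complex.normSq_eq_conj_mul_self, Complex.ofReal_re] at hstat
  exact Complex.normSq_eq_zero.1 ((mul_eq_zero.1 hstat).resolve_left hpos.ne')

theorem conjTranspose_mul_self_eq_of_stationary {K : Matrix (Fin r) (Fin r) ℂ} {s : ℝ}
    (hs : s ≠ 0) (hK : K.IsUpperTriangular) (hM : (traceGrad A K U V).IsUpperTriangular)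
    (hV : ∑ j : Fin (m + 1), A j * V * K ^ (j : ℕ) = (s : ℂ) • U)
    (hU : ∑ j : Fin (m + 1), K ^ (j : ℕ) * Uᴴ * A j = (s : ℂ) • Vᴴ) : Uᴴ * U = Vᴴ * V := by
  have hcomm := traceGrad_mul_sub_mul_traceGrad A K U V
  rw [hV, hU, Matrix.mul_smul, Matrix.smul_mul, ← smul_sub] at hcomm
  have hlower : ∀ i j, j ≤ i → (Uᴴ * U - Vᴴ * V) i j = 0 := fun i j hij => by
    have h := commutator_apply_eq_zero hM hK hij
    rw [hcomm, Matrix.smul_apply, smul_eq_mul] at h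
    exact (mul_eq_zero.1 h).resolve_left (Complex.ofReal_ne_zero.2 hs)
  have hherm : (Uᴴ * U - Vᴴ * V).IsHermitian :=
    (Matrix.isHermitian_conjTranspose_mul_self U).sub (Matrix.isHermitian_conjTranspose_mul_self V)
  rw [← sub_eq_zero]
  ext i j
  rcases le_total j i with h | h
  · exact hlower i j h
  · rw [← hherm.apply, hlower j i h, star_zero, Matrix.zero_apply]

theorem star_vec_vecMul_Qmat (U : Matrix (Fin n) (Fin r) ℂ) :
    star U.vec ᵥ* Qmat A μ Γ = (∑ j : Fin (m + 1), Cmat μ Γ ^ (j : ℕ) * Uᴴ * A j)ᵀ.vec := by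
  rw [Qmat, Matrix.vecMul_sum, Matrix.transpose_sum, Matrix.vec_sum]
  refine Finset.sum_congr rfl fun j _ => ?_
  rw [Matrix.star_vec, Matrix.vec_vecMul_kronecker, Matrix.transpose_mul, Matrix.transpose_mul,
    Matrix.mul_assoc]
  rfl

theorem SingularPair.sum_mul_pow_eq {s : ℝ} (h : SingularPair (Qmat A μ Γ) s U V) :
    ∑ j : Fin (m + 1), A j * V * Cmat μ Γ ^ (j : ℕ) = (s : ℂ) • U := by
  have hright := h.2.2.1
  rwa [Qmat, sum_kronecker_mulVec_vec A fun j => Cmat μ Γ ^ (j : ℕ), ← Matrix.vec_smul,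
    Matrix.vec_inj] at hright

theorem SingularPair.sum_pow_mul_eq {s : ℝ} (h : SingularPair (Qmat A μ Γ) s U V) :
    ∑ j : Fin (m + 1), Cmat μ Γ ^ (j : ℕ) * Uᴴ * A j = (s : ℂ) • Vᴴ := by
  have hleft := h.2.2.2
  have hstar : star V.vec = (Vᴴᵀ).vec := rfl
  rw [star_vec_vecMul_Qmat, hstar, ← Matrix.vec_smul, Matrix.vec_inj,
    ← Matrix.transpose_smul] at hleft
  exact Matrix.transpose_injective hleft

theorem SingularPair.conjTranspose_mul_self_eq
    (hpair : SingularPair (Qmat A μ Γ) (sigmaNeg r (Qmat A μ Γ)) U V)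
    (hmult : singValMult (Qmat A μ Γ) (sigmaNeg r (Qmat A μ Γ)) = 1)
    (hmax : ∀ Γ', sigmaNeg r (Qmat A μ Γ') ≤ sigmaNeg r (Qmat A μ Γ))
    (hpos : 0 < sigmaNeg r (Qmat A μ Γ)) : Uᴴ * U = Vᴴ * V :=
  conjTranspose_mul_self_eq_of_stationary hpos.ne'
    (isUpperTriangular_Cmat μ Γ) (fun _ _ hik => traceGrad_apply_eq_zero hmax hpair hmult hpos hik)
    hpair.sum_mul_pow_eq hpair.sum_pow_mul_eq

theorem norm_mul_pinv_le_one (hV : V.rank = r) (h : Uᴴ * U = Vᴴ * V) : ‖U * pinv V‖ ≤ 1 := by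
  obtain ⟨hVV, -, hherm, -⟩ := pinv_penrose V hV
  have hproj : (U * pinv V)ᴴ * (U * pinv V) = V * pinv V := by
    rw [Matrix.conjTranspose_mul, Matrix.mul_assoc, ← Matrix.mul_assoc Uᴴ, h, Matrix.mul_assoc,
      ← Matrix.mul_assoc, ← Matrix.conjTranspose_mul, hherm, ← Matrix.mul_assoc, hVV]
  have hidem : IsStarProjection (V * pinv V) :=
    ⟨by rw [IsIdempotentElem, ← Matrix.mul_assoc, hVV], hherm⟩
  have hsq : ‖U * pinv V‖ * ‖U * pinv V‖ ≤ 1 := by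
    rw [← Matrix.l2_opNorm_conjTranspose_mul_self, hproj]
    exact hidem.norm_le _
  nlinarith [norm_nonneg (U * pinv V)]

end Gram

section ZeroBlock

variable {ι κ K : Type*} [Fintype κ] [Field K]

theorem rank_add_le (M N : Matrix ι κ K) : (M + N).rank ≤ M.rank + N.rank := by
  have hrange : LinearMap.range (M + N).mulVecLin ≤
      LinearMap.range M.mulVecLin ⊔ LinearMap.range N.mulVecLin := by
    rintro _ ⟨x, rfl⟩
    rw [Matrix.mulVecLin_add]
    exact Submodule.add_mem_sup ⟨x, rfl⟩ ⟨x, rfl⟩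
  exact (Submodule.finrank_mono hrange).trans (Submodule.finrank_add_le_finrank_add_finrank _ _)

theorem rank_le_of_zero_block [Fintype ι] {M : Matrix ι κ K} {p : ι → Prop} {q : κ → Prop}
    [DecidablePred p] [DecidablePred q] (h : ∀ i j, p i ∨ q j ∨ M i j = 0) :
    M.rank ≤ Fintype.card {i // p i} + Fintype.card {j // q j} := by
  classical
  let D : Matrix ι ι K := Matrix.diagonal fun i => if p i then 1 else 0
  let D' : Matrix κ κ K := Matrix.diagonal fun j => if q j then 1 else 0
  have hsplit : M = D * M + (M - D * M) * D' := by
    ext i j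
    simp only [D, D', Matrix.add_apply, Matrix.mul_diagonal, Matrix.sub_apply,
      Matrix.diagonal_mul]
    rcases h i j with hp | hq | h0 <;> simp [*]
  have hD : D.rank = Fintype.card {i // p i} := by simp [D, Matrix.rank_diagonal]
  have hD' : D'.rank = Fintype.card {j // q j} := by simp [D', Matrix.rank_diagonal]
  rw [hsplit, ← hD, ← hD']
  exact (rank_add_le _ _).trans
    (add_le_add (Matrix.rank_mul_le_left _ _) (Matrix.rank_mul_le_right _ _))

theorem rank_add_le_of_zero_block {n r : ℕ} {M : Matrix (Fin r × Fin n) (Fin r × Fin n) K}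
    {k : Fin r} (h : ∀ l ≤ k, ∀ p ≥ k, ∀ a b, M (l, a) (p, b) = 0) :
    M.rank + n ≤ Fintype.card (Fin r × Fin n) := by
  have hrank := rank_le_of_zero_block (M := M) (p := fun x => k < x.1) (q := fun x => x.1 < k)
    fun ⟨l, a⟩ ⟨p, b⟩ => by
      rcases lt_or_ge k l with hl | hl
      · exact Or.inl hl
      rcases lt_or_ge p k with hp | hp
      · exact Or.inr (Or.inl hp)
      · exact Or.inr (Or.inr (h l hl p hp a b))
  have hcard : (r - 1 - k) * n + k * n + n = r * n := by
    rw [← add_mul, ← Nat.succ_mul]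
    congr 1
    omega
  rw [Fintype.card_congr (Equiv.prodSubtypeFstEquivSubtypeProd (p := fun l => k < l)),
    Fintype.card_congr (Equiv.prodSubtypeFstEquivSubtypeProd (p := fun l => l < k))] at hrank
  simp only [Fintype.card_prod, Fintype.card_fin, Fintype.card_subtype, Finset.filter_lt_eq_Ioi,
    Finset.filter_gt_eq_Iio, Fin.card_Ioi, Fin.card_Iio] at hrank ⊢
  omega

end ZeroBlock

section CornerPower

variable {ι R : Type*} [Fintype ι] [LinearOrder ι] [CommRing R] {K B : Matrix ι ι R}

theorem pow_apply_self_of_isUpperTriangular (hK : K.IsUpperTriangular) (i : ι) (j : ℕ) :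
    (K ^ j) i i = K i i ^ j := by
  induction j with
  | zero => simp
  | succ j ih => rw [pow_succ, mul_apply_self_of_isUpperTriangular (hK.pow j) hK, ih, pow_succ]

theorem pow_sub_pow_apply {i k : ι} (hik : i < k) (hK : K.IsUpperTriangular)
    (hB : B.IsUpperTriangular) (hKB : ∀ q l, i ≤ q → l ≤ k → (q, l) ≠ (i, k) → K q l = B q l)
    (j : ℕ) {l : ι} (hl : l ≤ k) :
    (K ^ j - B ^ j) i l =
      (K - B) i l * ∑ a ∈ Finset.range j, K i i ^ a * K l l ^ (j - 1 - a) := by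
  have hdiff : ∀ q l, i ≤ q → l ≤ k → (q, l) ≠ (i, k) → (K - B) q l = 0 := fun q l hq hl h =>
    sub_eq_zero.2 (hKB q l hq hl h)
  induction j generalizing l with
  | zero => simp
  | succ j ih =>
    have hstep : K ^ (j + 1) - B ^ (j + 1) = (K ^ j - B ^ j) * K + B ^ j * (K - B) := by
      rw [pow_succ, pow_succ]
      noncomm_ring
    have hleft : ((K ^ j - B ^ j) * K) i l = (K ^ j - B ^ j) i l * K l l := by
      refine Finset.sum_eq_single l (fun q _ hq => ?_) (by simp)
      rcases hq.lt_or_gt with h | h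
      · have hq0 : (K ^ j - B ^ j) i q = 0 := by
          rw [ih (h.le.trans hl), hdiff i q le_rfl (h.le.trans hl) (by grind), zero_mul]
        exact mul_eq_zero_of_left hq0 _
      · exact mul_eq_zero_of_right _ (hK h)
    have hright : (B ^ j * (K - B)) i l = K i i ^ j * (K - B) i l := by
      rw [hKB i i le_rfl hik.le (by grind), ← pow_apply_self_of_isUpperTriangular hB]
      refine Finset.sum_eq_single i (fun q _ hq => ?_) (by simp)
      rcases hq.lt_or_gt with h | h
      · exact mul_eq_zero_of_left (hB.pow j h) _
      · exact mul_eq_zero_of_right _ (hdiff q l h.le hl (by grind))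
    rw [hstep, Matrix.add_apply, hleft, hright, ih hl, Nat.add_sub_cancel, geom_sum₂_succ_eq]
    ring

end CornerPower

section Corner

variable {n m r : ℕ} (A : Fin (m + 1) → Matrix (Fin n) (Fin n) ℂ)

/-- The value `∑ⱼ (Kʲ)ᵀ ⊗ Aⱼ` of the matrix polynomial at a square matrix `K`, so that
`Qmat A μ Γ` is the value at `Cmat μ Γ`. -/
noncomputable def kroneckerEval (K : Matrix (Fin r) (Fin r) ℂ) :
    Matrix (Fin r × Fin n) (Fin r × Fin n) ℂ :=
  ∑ j : Fin (m + 1), (K ^ (j : ℕ))ᵀ ⊗ₖ A j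

theorem kroneckerEval_apply (K : Matrix (Fin r) (Fin r) ℂ) (l p : Fin r) (a b : Fin n) :
    kroneckerEval A K (l, a) (p, b) = ∑ j : Fin (m + 1), (K ^ (j : ℕ)) p l * A j a b := by
  rw [kroneckerEval, Matrix.sum_apply]
  rfl

theorem mul_single_kronecker_apply (M : Matrix (Fin r × Fin n) (Fin r × Fin n) ℂ) (i k p : Fin r)
    (N : Matrix (Fin n) (Fin n) ℂ) (x : Fin r × Fin n) (b : Fin n) :
    (M * (Matrix.single i k 1 ⊗ₖ N) : Matrix _ (Fin r × Fin n) ℂ) x (p, b) =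
      if k = p then ∑ c, M x (i, c) * N c b else 0 := by
  simp [Matrix.mul_apply, Fintype.sum_prod_type, Matrix.kroneckerMap_apply, Matrix.single_apply,
    ite_and]

variable {A} {K B : Matrix (Fin r) (Fin r) ℂ} {i k : Fin r} {N : Matrix (Fin n) (Fin n) ℂ}

theorem kroneckerEval_sub_kroneckerEval_apply (hik : i < k) (hK : K.IsUpperTriangular)
    (hB : B.IsUpperTriangular) (hKB : ∀ q l, i ≤ q → l ≤ k → (q, l) ≠ (i, k) → K q l = B q l)
    {l : Fin r} (hl : l ≤ k) (a b : Fin n) :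
    (kroneckerEval A K - kroneckerEval A B) (l, a) (i, b) =
      (K - B) i l * divDiff A (K i i) (K l l) a b := by
  simp only [Matrix.sub_apply (kroneckerEval A K), kroneckerEval_apply, divDiff, Matrix.sum_apply,
    Matrix.smul_apply, smul_eq_mul, Finset.mul_sum, ← Finset.sum_sub_distrib, ← sub_mul]
  refine Finset.sum_congr rfl fun j _ => ?_
  rw [← mul_assoc, ← pow_sub_pow_apply hik hK hB hKB j hl, Matrix.sub_apply]

theorem rank_kroneckerEval_sub_add_le (hik : i < k) (hK : K.IsUpperTriangular)
    (hB : B.IsUpperTriangular) (hKB : ∀ q l, i ≤ q → l ≤ k → (q, l) ≠ (i, k) → K q l = B q l)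
    (hne : (K - B) i k ≠ 0)
    (hN : divDiff A (K i i) (K k k) * N = -∑ j : Fin (m + 1), K k k ^ (j : ℕ) • A j) :
    (kroneckerEval A K -
      ((K - B) i k)⁻¹ • (kroneckerEval A B * (Matrix.single i k 1 ⊗ₖ N))).rank + n ≤
      Fintype.card (Fin r × Fin n) := by
  set γ := (K - B) i k
  let F : Matrix (Fin r × Fin n) (Fin r × Fin n) ℂ := Matrix.single i k 1 ⊗ₖ N
  have hF : F * F = 0 := by
    rw [← Matrix.mul_kronecker_mul, Matrix.single_mul_single_of_ne _ _ _ _ hik.ne',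
      Matrix.zero_kronecker]
  have hunit : IsUnit (1 + γ⁻¹ • F) :=
    IsNilpotent.isUnit_one_add ⟨2, by rw [sq, smul_mul_smul_comm, hF, smul_zero]⟩
  have hmul : (kroneckerEval A K - γ⁻¹ • (kroneckerEval A B * F)) * (1 + γ⁻¹ • F) =
      kroneckerEval A K + γ⁻¹ • ((kroneckerEval A K - kroneckerEval A B) * F) := by
    simp only [mul_add, mul_one, sub_mul, Matrix.mul_smul, Matrix.smul_mul, Matrix.mul_assoc, hF,
      Matrix.mul_zero, smul_zero, sub_zero, smul_sub]
    abel
  -- The unipotent factor clears the blocks in the rows `≤ k` and the columns `≥ k`.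
  rw [← Matrix.rank_mul_eq_left_of_isUnit_det _ _ ((Matrix.isUnit_iff_isUnit_det _).1 hunit), hmul]
  refine rank_add_le_of_zero_block (k := k) fun l hl p hp a b => ?_
  rw [Matrix.add_apply, Matrix.smul_apply, mul_single_kronecker_apply, kroneckerEval_apply]
  rcases (show k ≤ p from hp).eq_or_lt with rfl | hkp
  · simp only [if_true, kroneckerEval_sub_kroneckerEval_apply hik hK hB hKB hl]
    rcases hl.eq_or_lt with heq | hlk
    · simp only [heq, pow_apply_self_of_isUpperTriangular hK, mul_assoc, ← Finset.mul_sum,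
        ← Matrix.mul_apply, hN, Matrix.neg_apply, Matrix.sum_apply, Matrix.smul_apply, smul_eq_mul]
      rw [inv_mul_cancel_left₀ hne, add_neg_cancel]
    · have hil : (K - B) i l = 0 := sub_eq_zero.2 (hKB i l le_rfl hl (by grind))
      simp [hil, fun j : ℕ => hK.pow j hlk]
  · simp [hkp.ne, fun j : ℕ => hK.pow j (hl.trans_lt hkp)]

theorem sigmaNeg_kroneckerEval_mul_norm_le (hrn : r ≤ n) (hik : i < k) (hK : K.IsUpperTriangular)
    (hB : B.IsUpperTriangular) (hKB : ∀ q l, i ≤ q → l ≤ k → (q, l) ≠ (i, k) → K q l = B q l)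
    (hN : divDiff A (K i i) (K k k) * N = -∑ j : Fin (m + 1), K k k ^ (j : ℕ) • A j) :
    sigmaNeg r (kroneckerEval A K) * ‖(K - B) i k‖ ≤
      ‖kroneckerEval A B * (Matrix.single i k 1 ⊗ₖ N)‖ := by
  rcases eq_or_ne ((K - B) i k) 0 with h0 | hne
  · rw [h0, norm_zero, mul_zero]
    exact norm_nonneg _
  have hrank := rank_kroneckerEval_sub_add_le hik hK hB hKB hne hN
  rw [← le_div_iff₀ (norm_pos_iff.2 hne), div_eq_inv_mul, ← norm_inv, ← norm_smul, ← norm_neg]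
  rw [sub_eq_add_neg] at hrank
  exact sigmaNeg_le_norm_of_rank_add_le ((Nat.add_le_add_left hrn _).trans hrank)

end Corner

section Boundedness

variable {α : Type*} {f : Filter α} {n m r : ℕ}

theorem isBigO_one_of_apply {ι κ : Type*} [Fintype ι] [Fintype κ] [DecidableEq κ]
    {M : α → Matrix ι κ ℂ} (h : ∀ i j, (fun x => M x i j) =O[f] fun _ => (1 : ℝ)) :
    M =O[f] fun _ => (1 : ℝ) := by
  classical
  rw [funext fun x => Matrix.matrix_eq_sum_single (M x)]
  exact IsBigO.fun_sum fun i _ => IsBigO.fun_sum fun j _ =>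
    ((Matrix.singleLinearMap ℂ i j).toContinuousLinearMap.isBigO_comp _ f).trans (h i j)

theorem continuous_kroneckerEval (A : Fin (m + 1) → Matrix (Fin n) (Fin n) ℂ) :
    Continuous (kroneckerEval (r := r) A) := by
  refine continuous_matrix fun ⟨l, a⟩ ⟨p, b⟩ => ?_
  simp only [kroneckerEval_apply]
  refine continuous_finsetSum _ fun j _ => ?_
  exact ((continuous_id.pow _).matrix_elem p l).mul_const _

theorem isBigO_one_kroneckerEval (A : Fin (m + 1) → Matrix (Fin n) (Fin n) ℂ)
    {K : α → Matrix (Fin r) (Fin r) ℂ} (hK : K =O[f] fun _ => (1 : ℝ)) :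
    (fun x => kroneckerEval A (K x)) =O[f] fun _ => (1 : ℝ) := by
  refine isBigO_one_of_apply fun ⟨l, a⟩ ⟨p, b⟩ => ?_
  simp only [kroneckerEval_apply]
  have hpow (j : ℕ) : (fun x => (K x ^ j) p l) =O[f] fun _ => (1 : ℝ) := by
    simpa using ((Matrix.entryLinearMap ℂ ℂ p l).toContinuousLinearMap.isBigO_comp _ f).trans
      (hK.pow j)
  refine IsBigO.fun_sum fun j _ => ?_
  simpa only [mul_one] using (hpow j).mul (isBigO_const_const (A j a b) (one_ne_zero' ℝ) f)

/-- The part of `K` in the rows and columns `(p, l)` with `l - p < d`, which for upper triangular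
`K` is the band formed by the first `d` diagonals. -/
def band (d : ℕ) (K : Matrix (Fin r) (Fin r) ℂ) : Matrix (Fin r) (Fin r) ℂ :=
  Matrix.of fun p l => if (l : ℕ) < p + d then K p l else 0

theorem band_apply_of_lt {d : ℕ} (K : Matrix (Fin r) (Fin r) ℂ) {p l : Fin r}
    (h : (l : ℕ) < p + d) : band d K p l = K p l :=
  if_pos h

theorem band_apply_of_le {d : ℕ} (K : Matrix (Fin r) (Fin r) ℂ) {p l : Fin r}
    (h : (p : ℕ) + d ≤ l) : band d K p l = 0 :=
  if_neg h.not_gt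

theorem isUpperTriangular_band (d : ℕ) {K : Matrix (Fin r) (Fin r) ℂ}
    (hK : K.IsUpperTriangular) : (band d K).IsUpperTriangular := fun p l hlp => by
  simp [band, hK hlp]

theorem isBigO_one_apply {A : Fin (m + 1) → Matrix (Fin n) (Fin n) ℂ} (hrn : r ≤ n)
    {K : α → Matrix (Fin r) (Fin r) ℂ} {μ : Fin r → ℂ} {ε : ℝ} (hε : 0 < ε)
    (hK : ∀ x, (K x).IsUpperTriangular) (hdiag : ∀ x i, K x i i = μ i)
    (hD : ∀ i k, i < k → IsUnit (divDiff A (μ i) (μ k)).det)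
    (hσ : ∀ᶠ x in f, ε ≤ sigmaNeg r (kroneckerEval A (K x))) (i k : Fin r) :
    (fun x => K x i k) =O[f] fun _ => (1 : ℝ) := by
  induction hd : (k : ℕ) - i using Nat.strong_induction_on generalizing i k with
  | _ d ih =>
  rcases lt_trichotomy k i with hki | rfl | hik
  · simpa only [fun x => hK x hki] using isBigO_zero _ _
  · simpa only [hdiag] using isBigO_const_const (μ k) one_ne_zero f
  have hdpos : 0 < d := by omega
  have hband : (fun x => band d (K x)) =O[f] fun _ => (1 : ℝ) := by
    refine isBigO_one_of_apply fun p l => ?_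
    rcases lt_or_ge (l : ℕ) (p + d) with hl | hl
    · simpa only [band_apply_of_lt _ hl] using ih (l - p) (by omega) p l rfl
    · simpa only [band_apply_of_le _ hl] using isBigO_zero _ _
  have hagree (x) (q l : Fin r) (hq : i ≤ q) (hl : l ≤ k) (hne : (q, l) ≠ (i, k)) :
      K x q l = band d (K x) q l :=
    (band_apply_of_lt _ (by grind)).symm
  have hcorner (x) : (K x - band d (K x)) i k = K x i k := by
    rw [Matrix.sub_apply, band_apply_of_le _ (by omega), sub_zero]
  let N := -((divDiff A (μ i) (μ k))⁻¹ * ∑ j : Fin (m + 1), μ k ^ (j : ℕ) • A j)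
  have hN : divDiff A (μ i) (μ k) * N = -∑ j : Fin (m + 1), μ k ^ (j : ℕ) • A j := by
    rw [mul_neg, Matrix.mul_nonsing_inv_cancel_left _ _ (hD i k hik)]
  have hmul := (isBigO_one_kroneckerEval A hband).mul
    (isBigO_const_const (Matrix.single i k (1 : ℂ) ⊗ₖ N) (one_ne_zero' ℝ) f)
  simp only [mul_one] at hmul
  refine (IsBigO.of_bound ε⁻¹ ?_).trans hmul
  filter_upwards [hσ] with x hx
  have hbound := sigmaNeg_kroneckerEval_mul_norm_le (A := A) (N := N) hrn hik (hK x)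
    (isUpperTriangular_band d (hK x)) (hagree x) (by simpa only [hdiag] using hN)
  rw [hcorner] at hbound
  rw [← div_eq_inv_mul, le_div_iff₀' hε]
  exact (mul_le_mul_of_nonneg_right hx (norm_nonneg _)).trans hbound

end Boundedness

section Attainment

variable {n m r : ℕ} (A : Fin (m + 1) → Matrix (Fin n) (Fin n) ℂ) (μ : Fin r → ℂ)

theorem continuous_Qmat : Continuous (Qmat A μ) := by
  refine (continuous_kroneckerEval A).comp (continuous_matrix fun i j => ?_)
  simp only [Cmat, Matrix.of_apply]
  split_ifs <;> fun_prop

theorem continuous_sigmaNeg {ι : Type} [Fintype ι] [DecidableEq ι] (k : ℕ) :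
    Continuous (sigmaNeg k : Matrix ι ι ℂ → ℝ) := by
  let L := (Matrix.toEuclideanCLM (n := ι) (𝕜 := ℂ)).toAlgEquiv.toLinearMap
  unfold sigmaNeg singVal
  simp only [← Matrix.coe_toEuclideanCLM_eq_toEuclideanLin]
  exact (continuous_singularValues _).comp L.continuous_of_finiteDimensional

theorem sigmaNeg_nonneg {ι : Type} [Fintype ι] [DecidableEq ι] (k : ℕ) (B : Matrix ι ι ℂ) :
    0 ≤ sigmaNeg k B :=
  LinearMap.singularValues_nonneg _ _

variable {A μ}

theorem isBounded_le_sigmaNeg_Qmat (hrn : r ≤ n)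
    (hD : ∀ i k, i < k → IsUnit (divDiff A (μ i) (μ k)).det) {ε : ℝ} (hε : 0 < ε) :
    Bornology.IsBounded {Γ | ε ≤ sigmaNeg r (Qmat A μ Γ)} := by
  have hO : (fun Γ : StrictUpper r → ℂ => Γ) =O[𝓟 {Γ | ε ≤ sigmaNeg r (Qmat A μ Γ)}]
      fun _ => (1 : ℝ) := isBigO_pi.2 fun ⟨⟨i, k⟩, hik⟩ => by
    replace hik : i < k := hik
    refine (isBigO_one_apply hrn hε (isUpperTriangular_Cmat μ) (fun Γ i => by simp [Cmat]) hD
      (eventually_principal.2 fun Γ hΓ => hΓ) i k).congr_left fun Γ => ?_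
    simp [Cmat, hik, hik.ne]
  obtain ⟨c, hc⟩ := isBigO_principal.1 hO
  exact (Metric.isBounded_closedBall (x := 0) (r := c)).subset fun Γ hΓ => by
    simpa using hc Γ hΓ

theorem exists_attainedAt (hrn : r ≤ n)
    (hD : ∀ i k, i < k → IsUnit (divDiff A (μ i) (μ k)).det) :
    ∃ Γ : StrictUpper r → ℂ, AttainedAt A μ Γ := by
  have hmax : ∃ Γ, ∀ Γ', sigmaNeg r (Qmat A μ Γ') ≤ sigmaNeg r (Qmat A μ Γ) := by
    by_cases h0 : ∃ Γ, 0 < sigmaNeg r (Qmat A μ Γ)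
    · obtain ⟨Γ₀, hΓ₀⟩ := h0
      refine ((continuous_sigmaNeg r).comp (continuous_Qmat A μ)).exists_forall_ge' Γ₀ ?_
      rw [← Metric.cobounded_eq_cocompact]
      filter_upwards [Bornology.isBounded_def.1 (isBounded_le_sigmaNeg_Qmat hrn hD hΓ₀)] with Γ hΓ
      exact (not_le.1 (Set.notMem_ofPred_iff.1 hΓ)).le
    · push Not at h0
      exact ⟨0, fun Γ' => (h0 Γ').trans (sigmaNeg_nonneg _ _)⟩
  obtain ⟨Γ, hΓ⟩ := hmax
  exact ⟨Γ, le_antisymm (iSup_le fun Γ' => ENNReal.ofReal_le_ofReal (hΓ Γ'))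
    (le_iSup (fun Γ' => ENNReal.ofReal (sigmaNeg r (Qmat A μ Γ'))) Γ)⟩

end Attainment

section OptimalPerturbation

variable {n m r : ℕ} {A : Fin (m + 1) → Matrix (Fin n) (Fin n) ℂ}

theorem iInf_kappa_le_tau (hm : 0 < m) (hA : (A (Fin.last m)).rank = n) (S : Finset ℂ) :
    ⨅ (ν : Fin r → ℂ) (_ : ∀ i, ν i ∈ S), kappa A ν ≤ tau A S r := by
  refine le_iInf₂ fun Δ hΔ => ?_
  have hdet := det_matPoly_add_map_C_ne_zero hm hA Δ
  obtain ⟨ν, hν, hdvd⟩ := (feasible_iff A hdet).1 hΔ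
  exact (iInf₂_le ν hν).trans
    (iSup_le fun Γ => ENNReal.ofReal_le_ofReal (sigmaNeg_Qmat_le_norm2 hdet hdvd Γ))

variable {μ : Fin r → ℂ} {Γ : StrictUpper r → ℂ} {U V : Matrix (Fin n) (Fin r) ℂ}

theorem AttainedAt.toReal_kappa (h : AttainedAt A μ Γ) :
    (kappa A μ).toReal = sigmaNeg r (Qmat A μ Γ) := by
  rw [h, ENNReal.toReal_ofReal (sigmaNeg_nonneg _ _)]

theorem AttainedAt.sigmaNeg_le (h : AttainedAt A μ Γ) (Γ' : StrictUpper r → ℂ) :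
    sigmaNeg r (Qmat A μ Γ') ≤ sigmaNeg r (Qmat A μ Γ) :=
  (ENNReal.ofReal_le_ofReal_iff (sigmaNeg_nonneg _ _)).1
    ((le_iSup (fun Γ' => ENNReal.ofReal (sigmaNeg r (Qmat A μ Γ'))) Γ').trans_eq h)

theorem AttainedAt.feasible_optPert (hatt : AttainedAt A μ Γ) (hm : 0 < m)
    (hA : (A (Fin.last m)).rank = n) {S : Finset ℂ} (hμ : ∀ i, μ i ∈ S)
    (hpair : SingularPair (Qmat A μ Γ) (sigmaNeg r (Qmat A μ Γ)) U V) (hV : V.rank = r) :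
    Feasible A S r (optPert A μ U V) := by
  set Δ := optPert A μ U V with hΔ
  refine (feasible_iff A (det_matPoly_add_map_C_ne_zero hm hA Δ)).2 ⟨μ, hμ, ?_⟩
  rw [matPoly_add_map_C]
  refine prod_dvd_det_matPoly (Γ := Γ) hV ?_
  have hΔV : Δ * V = -((sigmaNeg r (Qmat A μ Γ) : ℂ) • U) := by
    rw [hΔ, optPert, hatt.toReal_kappa, Matrix.neg_mul, Matrix.smul_mul, Matrix.mul_assoc,
      pinv_mul_self hV, Matrix.mul_one]
  rw [Qmat_add_single, Matrix.add_mulVec, hpair.2.2.1, Matrix.kronecker_mulVec_vec,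
    Matrix.transpose_one, Matrix.mul_one, hΔV, Matrix.vec_neg, Matrix.vec_smul, add_neg_cancel]

theorem AttainedAt.norm2_optPert_le (hatt : AttainedAt A μ Γ)
    (hpair : SingularPair (Qmat A μ Γ) (sigmaNeg r (Qmat A μ Γ)) U V)
    (hmult : singValMult (Qmat A μ Γ) (sigmaNeg r (Qmat A μ Γ)) = 1) (hV : V.rank = r) :
    norm2 (optPert A μ U V) ≤ sigmaNeg r (Qmat A μ Γ) := by
  have hs := sigmaNeg_nonneg r (Qmat A μ Γ)
  have hnorm : norm2 (optPert A μ U V) = sigmaNeg r (Qmat A μ Γ) * ‖U * pinv V‖ := by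
    change ‖optPert A μ U V‖ = _
    rw [optPert, hatt.toReal_kappa, norm_neg, norm_smul, Complex.norm_real, Real.norm_of_nonneg hs]
  rw [hnorm]
  rcases hs.eq_or_lt with h0 | hpos
  · rw [← h0, zero_mul]
  · have hgram := hpair.conjTranspose_mul_self_eq hmult hatt.sigmaNeg_le hpos
    exact mul_le_of_le_one_right hs (norm_mul_pinv_le_one hV hgram)

end OptimalPerturbation

end SpecEig

theorem theorem3p1 {n m r : ℕ} (hm : 0 < m) (hr : 0 < r)
    (A : Fin (m + 1) → Matrix (Fin n) (Fin n) ℂ) (hA : (A (Fin.last m)).rank = n)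
    (S : Finset ℂ) :
    -- for `r ≤ n` and generic `μ` the inner supremum is attained
    (r ≤ n → ∀ μ : Fin r → ℂ,
      (∀ k l : Fin r, k < l → (divDiff A (μ k) (μ l)).rank = n) →
        ∃ Γ : StrictUpper r → ℂ, AttainedAt A μ Γ) ∧
    -- at an optimal `(μ, Γ)`, under the multiplicity and linear independence assumptions
    (∀ (μ : Fin r → ℂ) (Γ : StrictUpper r → ℂ) (U V : Matrix (Fin n) (Fin r) ℂ),
      OuterOptimal A S μ → AttainedAt A μ Γ →
      SingularPair (Qmat A μ Γ) (sigmaNeg r (Qmat A μ Γ)) U V →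
      singValMult (Qmat A μ Γ) (sigmaNeg r (Qmat A μ Γ)) = 1 →
      V.rank = r →
        tau A S r = (⨅ (ν : Fin r → ℂ) (_ : ∀ i, ν i ∈ S), ⨆ Γ' : StrictUpper r → ℂ,
          ENNReal.ofReal (sigmaNeg r (Qmat A ν Γ'))) ∧
        Feasible A S r (optPert A μ U V) ∧
        ENNReal.ofReal (norm2 (optPert A μ U V)) = tau A S r ∧
        ∀ Δ : Matrix (Fin n) (Fin n) ℂ, Feasible A S r Δ → norm2 (optPert A μ U V) ≤ norm2 Δ) := by
  refine ⟨fun hrn μ hD => exists_attainedAt hrn fun k l hkl =>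
    isUnit_det_of_rank_eq_card ((hD k l hkl).trans (Fintype.card_fin n).symm),
    fun μ Γ U V hopt hatt hpair hmult hV => ?_⟩
  have hinf : (⨅ (ν : Fin r → ℂ) (_ : ∀ i, ν i ∈ S), kappa A ν) = kappa A μ :=
    le_antisymm (iInf₂_le μ hopt.1) (le_iInf₂ hopt.2)
  have hlower : kappa A μ ≤ tau A S r := hinf ▸ iInf_kappa_le_tau hm hA S
  have hfeas := hatt.feasible_optPert hm hA hopt.1 hpair hV
  have htau_le : tau A S r ≤ ENNReal.ofReal (norm2 (optPert A μ U V)) := iInf₂_le _ hfeas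
  have hupper : ENNReal.ofReal (norm2 (optPert A μ U V)) ≤ kappa A μ :=
    (ENNReal.ofReal_le_ofReal (hatt.norm2_optPert_le hpair hmult hV)).trans_eq hatt.symm
  have hmin : ENNReal.ofReal (norm2 (optPert A μ U V)) = tau A S r :=
    le_antisymm (hupper.trans hlower) htau_le
  refine ⟨(le_antisymm (htau_le.trans hupper) hlower).trans hinf.symm, hfeas, hmin, fun Δ hΔ => ?_⟩
  have htau_le_norm2 : tau A S r ≤ ENNReal.ofReal (norm2 Δ) := iInf₂_le Δ hΔ
  exact (ENNReal.ofReal_le_ofReal_iff (norm_nonneg _)).1 (hmin.trans_le htau_le_norm2)
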